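/- An equivalence relation $E$ on a Polish space $X$ is called Borel if it is a Borel subset of $X\times X$. For equivalence relations $E,F$ on Polish spaces $X,Y$ respectively, write $E\le_B F$ if there is a Borel map $\theta:X\to Y$ such that $x\mathrel{E}y\iff\theta(x)\mathrel{F}\theta(y)$ for all $x,y\in X$; $E$ and $F$ are Borel incomparable if neither $E\le_B F$ nor $F\le_B E$. For $1\le p<\infty$ let $\mathbb{R}^\omega/\ell_p$ denote the equivalence relation on $\mathbb{R}^\omega$ under which $x,y$ are equivalent if and only if $\sum_{n<\omega}|x_n-y_n|^p<\infty$. Corollary. Let $1\le p<q<\infty$. Then there is a family $(\mathbf{E}_\xi)_{\xi\in\{0,1\}^\omega}$ of Borel equivalence relations (on Polish spaces) such that $\mathbb{R}^\omega/\ell_p\le_B\mathbf{E}_\xi\le_B\mathbb{R}^\omega/\ell_q$ for every $\xi\in\{0,1\}^\omega$, and such that $\mathbf{E}_\xi$ and $\mathbf{E}_\zeta$ are Borel incomparable for all distinct $\xi,\zeta\in\{0,1\}^\omega$. -/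

import Mathlib

open scoped ENNReal

/-- `E ≤_B F` for equivalence relations `E`, `F` on Polish spaces `X`, `Y`: there is a Borel map
`θ : X → Y` with `x E y ↔ θ x F θ y` for all `x y`. -/
def BorelReducible {X Y : Type*}
    [TopologicalSpace X] [PolishSpace X] [MeasurableSpace X] [BorelSpace X]
    [TopologicalSpace Y] [PolishSpace Y] [MeasurableSpace Y] [BorelSpace Y]
    (E : Setoid X) (F : Setoid Y) : Prop :=
  ∃ θ : X → Y, Measurable θ ∧ ∀ x y : X, E x y ↔ F (θ x) (θ y)

/-- Neither equivalence relation is Borel reducible to the other. -/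
def BorelIncomparable {X Y : Type*}
    [TopologicalSpace X] [PolishSpace X] [MeasurableSpace X] [BorelSpace X]
    [TopologicalSpace Y] [PolishSpace Y] [MeasurableSpace Y] [BorelSpace Y]
    (E : Setoid X) (F : Setoid Y) : Prop :=
  ¬ BorelReducible E F ∧ ¬ BorelReducible F E

/-- A Borel equivalence relation: a Polish space with its Borel σ-algebra and an equivalence
relation on it which is a Borel subset of the square of the space. -/
structure BorelEquivRel where
  carrier : Type
  [topologicalSpace : TopologicalSpace carrier]
  [polishSpace : PolishSpace carrier]
  [measurableSpace : MeasurableSpace carrier]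
  [borelSpace : BorelSpace carrier]
  rel : Setoid carrier
  measurableSet_rel : MeasurableSet {z : carrier × carrier | rel z.1 z.2}

attribute [instance] BorelEquivRel.topologicalSpace BorelEquivRel.polishSpace
  BorelEquivRel.measurableSpace BorelEquivRel.borelSpace

/-- The equivalence relation `ℝ^ω / ℓ_p` on `ℝ^ω`: two real sequences are related when their
difference lies in `ℓ_p`. -/
def realModEllp (p : ℝ≥0∞) : Setoid (ℕ → ℝ) where
  r x y := Memℓp (x - y) p
  iseqv :=
    { refl := fun x => by
        rw [sub_self]
        exact zero_memℓp
      symm := fun {x y} h => by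
        rw [← neg_sub]
        exact h.neg
      trans := fun {x y z} h₁ h₂ => by
        rw [← sub_add_sub_cancel x y z]
        exact h₁.add h₂ }

/-!
Let `E a`, for a sequence `a` of natural numbers, be the equivalence relation on
`ℝ^ω × ℤ^(ω × ω)` given by the finiteness of

  `∑ i, |x i - x' i| ^ p + ∑ k, ∑ c, δ (a k) * |y (k, c) - y' (k, c)| ^ t (a k)`,

where `t 0 > t 1 > ⋯` are exponents in `(p, q)` and the weights `δ n = 2⁻¹ ^ d n` tend to `0` very
fast (`Scales`, `Scales.rel`). The real coordinates give `ℓ_p ≤ E a`. For `1 ≤ t ≤ t 0 < q`, the line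
with the metric `|x - y| ^ (t / q)` embeds into `ℓ_q`, with distortion bounded uniformly in `t`, by
winding it around circles of radius `2 ^ (-k t / q)` at the speeds `2 ^ k`; hence `E a ≤ ℓ_q`
(`tsum_helixMap_sub_ne_top_iff`). For `ξ` in the Cantor space, `a = branchCode ξ` enumerates codes of
the finite restrictions of `ξ`, so that for `ξ ≠ ζ` infinitely many values of one sequence are not
values of the other. It remains to see that `E a` does not reduce to `E b` when infinitely many
values of `a` are not values of `b` (`Scales.not_borelReducible`).

A Borel reduction is continuous on a dense `G_δ` set. A Baire category argument then yields places
`k m`, a generic point `z` and consecutive finite blocks of coordinates of the target such that,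
among the points which differ from `z` at the places `k m` only, by integers in prescribed finite
ranges, the reduction acts additively up to a summable error: the `m`-th block depends only on the
value at the place `k m` (`LocalizableFamily.exists_block_decomposition`). The places can be chosen so
that every scale `n = a k` not among the values of `b` is represented infinitely often.

For an additive reduction, the cost in the target of a single step at scale `n` is bounded by a
constant times `δ n`, for all large `n` and almost all places of this scale; otherwise one could
collect steps whose costs are summable in the domain but not in the target. Now follow a chain of
`N` such steps. A target coordinate of a scale `m < n` is integer valued, and its weight `δ m` is so
much larger than `δ n` that it cannot move in a single step. By convexity, all the other target
coordinates, of scales `m > n` or real, grow at most by the factor `N ^ t (n + 1)`, since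
`p ≤ t m ≤ t (n + 1)` (`Scales.powTerm_chain_le_of_notMem_range`). In the domain the cost grows by the
factor `N ^ t n`. As `t (n + 1) < t n`, choosing `N` large at each scale and repeating the chain at
suitably many places gives two points which are inequivalent in the domain and whose images are
equivalent in the target (`Scales.false_of_additive`).
-/

open Filter Topology PiNat

/-! ### Continuity of Borel maps on comeagre sets -/

theorem Measurable.exists_residual_continuousOn {X Y : Type*} [TopologicalSpace X]
    [MeasurableSpace X] [BorelSpace X] [TopologicalSpace Y] [SecondCountableTopology Y]
    [MeasurableSpace Y] [OpensMeasurableSpace Y] {f : X → Y} (hf : Measurable f) :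
    ∃ C ∈ residual X, ContinuousOn f C := by
  classical
  have hb := TopologicalSpace.isBasis_countableBasis Y
  have key : ∀ u : Set Y, ∃ O : Set X, u ∈ TopologicalSpace.countableBasis Y →
      IsOpen O ∧ f ⁻¹' u =ᶠ[residual X] O := by
    intro u
    by_cases hu : u ∈ TopologicalSpace.countableBasis Y
    · obtain ⟨O, hO, h⟩ := (hf (hb.isOpen hu).measurableSet).residualEq_isOpen
      exact ⟨O, fun _ => ⟨hO, h⟩⟩
    · exact ⟨∅, fun h => absurd h hu⟩
  choose O hO using key
  refine ⟨{x | ∀ u ∈ TopologicalSpace.countableBasis Y, x ∈ f ⁻¹' u ↔ x ∈ O u}, ?_, ?_⟩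
  · rw [← Filter.eventually_mem_set]
    simp only [Set.mem_ofPred_eq]
    rw [eventually_countable_ball (TopologicalSpace.countable_countableBasis Y)]
    intro u hu
    exact (hO u hu).2.mem_iff
  · rw [continuousOn_iff']
    have : ∀ t : Set Y, IsOpen t → ∃ u, IsOpen u ∧
        f ⁻¹' t ∩ {x | ∀ u ∈ TopologicalSpace.countableBasis Y, x ∈ f ⁻¹' u ↔ x ∈ O u} =
        u ∩ {x | ∀ u ∈ TopologicalSpace.countableBasis Y, x ∈ f ⁻¹' u ↔ x ∈ O u} := by
      intro t ht
      refine ⟨⋃ u ∈ {u | u ∈ TopologicalSpace.countableBasis Y ∧ u ⊆ t}, O u,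
        isOpen_biUnion fun u hu => (hO u hu.1).1, ?_⟩
      ext x
      simp only [Set.mem_inter_iff, Set.mem_preimage, Set.mem_ofPred_eq, Set.mem_iUnion,
        exists_prop, and_congr_left_iff]
      intro hx
      constructor
      · intro hxt
        obtain ⟨u, hu, hxu, hut⟩ := hb.exists_subset_of_mem_open hxt ht
        exact ⟨u, ⟨hu, hut⟩, (hx u hu).1 hxu⟩
      · rintro ⟨u, ⟨hu, hut⟩, hxu⟩
        exact hut ((hx u hu).2 hxu)
    exact this

/-- The comeagre set of continuity can be taken invariant under a countable group of
translations, here the finitely supported sequences. -/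
theorem Measurable.exists_isGδ_translationInvariant_continuousOn {Y : Type*} [TopologicalSpace Y]
    [SecondCountableTopology Y] [MeasurableSpace Y] [OpensMeasurableSpace Y]
    {f : (ℕ → ℤ) → Y} (hf : Measurable f) :
    ∃ C : Set (ℕ → ℤ), IsGδ C ∧ Dense C ∧ (∀ g : ℕ →₀ ℤ, ∀ x ∈ C, ⇑g + x ∈ C) ∧
      ContinuousOn f C := by
  obtain ⟨C, hC, hcont⟩ := hf.exists_residual_continuousOn
  obtain ⟨D, hDC, hDδ, hDd⟩ := mem_residual.1 hC
  refine ⟨⋂ g : ℕ →₀ ℤ, (fun x => ⇑g + x) ⁻¹' D, ?_, ?_, ?_, ?_⟩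
  · exact IsGδ.iInter fun g => hDδ.preimage (continuous_const.add continuous_id)
  · refine dense_iInter_of_Gδ (fun g => hDδ.preimage (continuous_const.add continuous_id))
      fun g => ?_
    exact hDd.preimage (Homeomorph.addLeft (⇑g : ℕ → ℤ)).isOpenMap
  · intro g x hx
    simp only [Set.mem_iInter, Set.mem_preimage] at hx ⊢
    intro g'
    have := hx (g' + g)
    rwa [Finsupp.coe_add, add_assoc] at this
  · refine hcont.mono fun x hx => hDC ?_
    have := Set.mem_iInter.1 hx 0
    simpa using this

/-! ### Localization of a family of quasi-metrics -/

/-- The finitely supported integer sequences which vanish from `L` on and whose values lie between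
`0` and the given bounds. -/
def boxBelow (P : ℕ → ℕ) (L : ℕ) : Set (ℕ →₀ ℤ) :=
  {g | (∀ j, L ≤ j → g j = 0) ∧ ∀ j, 0 ≤ g j ∧ g j ≤ P j}

theorem finite_boxBelow (P : ℕ → ℕ) (L : ℕ) : (boxBelow P L).Finite := by
  have h : (Set.pi Set.univ fun j : Fin L => Set.Icc (0 : ℤ) (P j)).Finite :=
    Set.Finite.pi fun j => Set.finite_Icc _ _
  refine Set.Finite.of_injOn (f := fun g (j : Fin L) => g j) ?_ ?_ h
  · intro g hg j _
    exact hg.2 j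
  · intro g hg g' hg' hgg
    ext j
    rcases lt_or_ge j L with hj | hj
    · exact congrFun hgg ⟨j, hj⟩
    · rw [hg.1 j hj, hg'.1 j hj]

theorem exists_cylinder_subset {U : Set (ℕ → ℤ)} (hU : IsOpen U) {x : ℕ → ℤ} (hx : x ∈ U)
    (L : ℕ) : ∃ n, L ≤ n ∧ cylinder x n ⊆ U := by
  obtain ⟨v, ⟨y, n, rfl⟩, hxv, hvU⟩ :=
    (isTopologicalBasis_cylinders (fun _ : ℕ => ℤ)).exists_subset_of_mem_open hx hU
  refine ⟨max L n, le_max_left _ _, ?_⟩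
  rw [mem_cylinder_iff_eq] at hxv
  rw [← hxv] at hvU
  exact (cylinder_anti x (le_max_right _ _)).trans hvU

/-- A family of `ℝ≥0∞`-valued quasi-metrics on `ℕ → ℤ`, jointly continuous on the square of a dense
`G_δ` set `C` which is invariant under finitely supported translations, and summable on pairs of
points which differ at finitely many places. -/
structure LocalizableFamily (C : Set (ℕ → ℤ)) (K : ℝ≥0∞)
    (h : ℕ → (ℕ → ℤ) → (ℕ → ℤ) → ℝ≥0∞) : Prop where
  isGδ : IsGδ C
  dense : Dense C
  add_mem : ∀ g : ℕ →₀ ℤ, ∀ x ∈ C, ⇑g + x ∈ C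
  const_ne_top : K ≠ ∞
  self : ∀ i x, h i x x = 0
  symm : ∀ i x y, h i x y = h i y x
  triangle : ∀ i x y z, h i x z ≤ K * (h i x y + h i y z)
  continuousOn : ∀ i, ContinuousOn (fun w : (ℕ → ℤ) × (ℕ → ℤ) => h i w.1 w.2) (C ×ˢ C)
  tsum_ne_top : ∀ (g g' : ℕ →₀ ℤ) (x : ℕ → ℤ), ∑' i, h i (⇑g + x) (⇑g' + x) ≠ ∞

namespace LocalizableFamily

variable {C : Set (ℕ → ℤ)} {K : ℝ≥0∞} {h : ℕ → (ℕ → ℤ) → (ℕ → ℤ) → ℝ≥0∞}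

theorem continuousOn_translate (H : LocalizableFamily C K h) (i : ℕ) (g g' : ℕ →₀ ℤ) :
    ContinuousOn (fun w => h i (⇑g + w) (⇑g' + w)) C := by
  refine (H.continuousOn i).comp (f := fun w => (⇑g + w, ⇑g' + w)) ?_ ?_
  · exact ((continuous_const.add continuous_id).prodMk
      (continuous_const.add continuous_id)).continuousOn
  · intro w hw
    exact ⟨H.add_mem g w hw, H.add_mem g' w hw⟩

/-- By the Baire category theorem, every nonempty open set contains a cylinder on which the tails
of the sums between two translates are uniformly small. -/
theorem exists_tail_le (H : LocalizableFamily C K h) {G : Set (ℕ →₀ ℤ)} (hG : G.Finite)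
    {ε : ℝ≥0∞} (hε : 0 < ε) {U : Set (ℕ → ℤ)} (hU : IsOpen U) (hne : U.Nonempty) :
    ∃ (V : Set (ℕ → ℤ)) (l : ℕ), IsOpen V ∧ V.Nonempty ∧ V ⊆ U ∧
      ∀ w ∈ V ∩ C, ∀ g ∈ G, ∀ g' ∈ G, ∑' i, h (i + l) (⇑g + w) (⇑g' + w) ≤ ε := by
  let D : ℕ → Set (ℕ → ℤ) := fun l =>
    {w | w ∈ C ∧ ∀ g ∈ G, ∀ g' ∈ G, ∑' i, h (i + l) (⇑g + w) (⇑g' + w) ≤ ε}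
  -- `D l` is closed relative to `C`, and the sets `D l` exhaust `C`
  have hcover : C ⊆ ⋃ l, closure (D l) := by
    intro w hw
    have : ∀ᶠ l in atTop, ∀ g ∈ G, ∀ g' ∈ G, ∑' i, h (i + l) (⇑g + w) (⇑g' + w) ≤ ε := by
      rw [Filter.eventually_all_finite hG]
      intro g _
      rw [Filter.eventually_all_finite hG]
      intro g' _
      have := ENNReal.tendsto_sum_nat_add (fun i => h i (⇑g + w) (⇑g' + w)) (H.tsum_ne_top g g' w)
      exact this.eventually (Iic_mem_nhds hε)
    obtain ⟨l, hl⟩ := this.exists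
    exact Set.mem_iUnion.2 ⟨l, subset_closure ⟨hw, hl⟩⟩
  have hd := H.isGδ.dense_iUnion_interior_of_closed H.dense (fun l => isClosed_closure) hcover
  obtain ⟨w, hwU, hw⟩ := hd.inter_open_nonempty U hU hne
  obtain ⟨l, hl⟩ := Set.mem_iUnion.1 hw
  refine ⟨U ∩ interior (closure (D l)), l, hU.inter isOpen_interior, ⟨w, hwU, hl⟩,
    Set.inter_subset_left, ?_⟩
  rintro v ⟨⟨-, hv⟩, hvC⟩ g hg g' hg'
  refine ENNReal.tsum_le_of_sum_range_le fun n => ?_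
  have hcl : v ∈ closure (D l) := interior_subset hv
  have hcont : ContinuousWithinAt
      (fun w => ∑ i ∈ Finset.range n, h (i + l) (⇑g + w) (⇑g' + w)) (D l) v := by
    refine ContinuousWithinAt.mono ?_ (fun w hw => hw.1 : D l ⊆ C)
    exact (continuousOn_finsetSum _ fun i _ => H.continuousOn_translate (i + l) g g') v hvC
  have : (𝓝[D l] v).NeBot := mem_closure_iff_nhdsWithin_neBot.1 hcl
  refine le_of_tendsto hcont ?_
  filter_upwards [self_mem_nhdsWithin] with w hw
  exact (ENNReal.sum_le_tsum _).trans (hw.2 g hg g' hg')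

/-- One stage of the localization: after extending the given cylinder, all translates by the finite
set `G` lie in a prescribed dense open set, the tails of the sums between two translates are small,
and so are the heads of the sums between two points of one translate. -/
theorem exists_stage (H : LocalizableFamily C K h) {G : Set (ℕ →₀ ℤ)} (hG : G.Finite)
    {O : Set (ℕ → ℤ)} (hO : IsOpen O) (hOd : Dense O) {ε : ℝ≥0∞} (hε : 0 < ε)
    {S : Set ℕ} (hS : S.Infinite) (z : ℕ → ℤ) (L l₀ : ℕ) :
    ∃ (z' : ℕ → ℤ) (k l : ℕ), z' ∈ cylinder z L ∧ L ≤ k ∧ k ∈ S ∧ l₀ < l ∧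
      (∀ g ∈ G, ∀ w ∈ cylinder z' k, ⇑g + w ∈ O) ∧
      (∀ w ∈ cylinder z' k ∩ C, ∀ g ∈ G, ∀ g' ∈ G,
        ∑' i, h (i + l) (⇑g + w) (⇑g' + w) ≤ ε) ∧
      (∀ g ∈ G, ∀ w ∈ cylinder z' k ∩ C, ∀ w' ∈ cylinder z' k ∩ C,
        ∑ i ∈ Finset.range l, h i (⇑g + w) (⇑g + w') ≤ ε) := by
  -- the translates of `O` meet in a dense open set
  let O' : Set (ℕ → ℤ) := ⋂ g ∈ G, (fun w => ⇑g + w) ⁻¹' O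
  have hO' : IsOpen O' :=
    hG.isOpen_biInter fun g _ => hO.preimage (continuous_const.add continuous_id)
  have hOd' : Dense O' := by
    refine dense_biInter_of_isOpen
      (fun g _ => hO.preimage (continuous_const.add continuous_id)) hG.countable fun g _ => ?_
    exact hOd.preimage (Homeomorph.addLeft (⇑g : ℕ → ℤ)).isOpenMap
  have hne : (cylinder z L ∩ O').Nonempty :=
    hOd'.inter_open_nonempty _ (isOpen_cylinder _ z L) ⟨z, self_mem_cylinder z L⟩
  obtain ⟨V, l₁, hV, hVne, hVU, htail⟩ :=
    H.exists_tail_le hG hε ((isOpen_cylinder _ z L).inter hO') hne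
  obtain ⟨z', hz'V, hz'C⟩ := H.dense.inter_open_nonempty V hV hVne
  set l := max l₁ (l₀ + 1) with hl
  -- continuity at the point `z'` of `C` makes the heads small
  have hcont : ∀ g ∈ G, ∀ᶠ w : (ℕ → ℤ) × (ℕ → ℤ) in 𝓝 (z', z'), w ∈ C ×ˢ C →
      ∑ i ∈ Finset.range l, h i (⇑g + w.1) (⇑g + w.2) ≤ ε := by
    intro g _
    rw [← eventually_nhdsWithin_iff]
    have hc : ContinuousOn (fun w : (ℕ → ℤ) × (ℕ → ℤ) =>
        ∑ i ∈ Finset.range l, h i (⇑g + w.1) (⇑g + w.2)) (C ×ˢ C) := by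
      refine continuousOn_finsetSum _ fun i _ => ?_
      refine (H.continuousOn i).comp
        (f := fun w : (ℕ → ℤ) × (ℕ → ℤ) => (⇑g + w.1, ⇑g + w.2)) ?_ ?_
      · exact ((continuous_const.add continuous_fst).prodMk
          (continuous_const.add continuous_snd)).continuousOn
      · rintro w ⟨hw1, hw2⟩
        exact ⟨H.add_mem g _ hw1, H.add_mem g _ hw2⟩
    have h0 := hc (z', z') ⟨hz'C, hz'C⟩
    refine h0.tendsto.eventually (Iic_mem_nhds ?_)
    simpa [H.self] using hε
  have hcont' := (Filter.eventually_all_finite hG).2 hcont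
  rw [nhds_prod_eq] at hcont'
  obtain ⟨pa, hpa, pb, hpb, hab⟩ := Filter.eventually_prod_iff.1 hcont'
  obtain ⟨W, hWsub, hW, hzW⟩ := mem_nhds_iff.1 (hpa.and hpb)
  obtain ⟨n, hLn, hn⟩ := exists_cylinder_subset (hV.inter hW) ⟨hz'V, hzW⟩ L
  obtain ⟨k, hkS, hnk⟩ := hS.exists_gt n
  have hsub : cylinder z' k ⊆ V ∩ W := (cylinder_anti z' hnk.le).trans hn
  refine ⟨z', k, l, (hVU hz'V).1, hLn.trans hnk.le, hkS, by omega, ?_, ?_, ?_⟩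
  · intro g hg w hw
    exact Set.mem_iInter₂.1 (hVU (hsub hw).1).2 g hg
  · rintro w ⟨hw, hwC⟩ g hg g' hg'
    refine le_trans ?_ (htail w ⟨(hsub hw).1, hwC⟩ g hg g' hg')
    obtain ⟨r, hr⟩ : ∃ r, l = r + l₁ := ⟨l - l₁, by omega⟩
    simp only [hr, ← add_assoc]
    exact ENNReal.tsum_comp_le_tsum_of_injective (add_left_injective r)
      (fun i => h (i + l₁) (⇑g + w) (⇑g' + w))
  · rintro g hg w ⟨hw, hwC⟩ w' ⟨hw', hwC'⟩
    exact hab (hWsub (hsub hw).2).1 (hWsub (hsub hw').2).2 g hg ⟨hwC, hwC'⟩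

end LocalizableFamily

/-! ### Splitting into blocks -/

/-- The integer sequence which carries `x m` at the place `k m` and vanishes off the range of
`k`. -/
noncomputable def spread (k : ℕ → ℕ) (x : ℕ → ℤ) : ℕ → ℤ := Function.extend k x 0

/-- The part of `spread k x` carried by the first `m` places of `k`. -/
noncomputable def partialSpread (k : ℕ → ℕ) (x : ℕ → ℤ) (m : ℕ) : ℕ →₀ ℤ :=
  ∑ i ∈ Finset.range m, Finsupp.single (k i) (x i)

section Spread

variable {k : ℕ → ℕ}

theorem spread_apply (hk : StrictMono k) (x : ℕ → ℤ) (m : ℕ) : spread k x (k m) = x m :=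
  hk.injective.extend_apply _ _ _

theorem spread_apply_of_notMem (x : ℕ → ℤ) {j : ℕ} (hj : ∀ m, k m ≠ j) : spread k x j = 0 :=
  Function.extend_apply' _ _ _ fun ⟨m, hm⟩ => hj m hm

theorem spread_single (hk : StrictMono k) (m : ℕ) (a : ℤ) :
    spread k (Pi.single m a) = Finsupp.single (k m) a := by
  ext j
  by_cases hj : ∃ i, k i = j
  · obtain ⟨i, rfl⟩ := hj
    rw [spread_apply hk, Finsupp.single_apply, Pi.single_apply]
    simp [hk.injective.eq_iff, eq_comm]
  · push Not at hj
    rw [spread_apply_of_notMem _ hj, Finsupp.single_apply, if_neg (hj m)]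

theorem spread_zero : spread k 0 = 0 := by
  ext j
  by_cases hj : ∃ i, k i = j
  · simp [spread, Function.extend, hj]
  · simp [spread, Function.extend, hj]

theorem partialSpread_apply (hk : StrictMono k) (x : ℕ → ℤ) (m i : ℕ) :
    partialSpread k x m (k i) = if i < m then x i else 0 := by
  classical
  simp [partialSpread, Finsupp.finsetSum_apply, Finsupp.single_apply, hk.injective.eq_iff]

theorem partialSpread_apply_of_notMem (x : ℕ → ℤ) (m : ℕ) {j : ℕ} (hj : ∀ i, k i ≠ j) :
    partialSpread k x m j = 0 := by
  classical
  simp [partialSpread, Finsupp.finsetSum_apply, hj]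

theorem spread_apply_of_lt (hk : StrictMono k) (x : ℕ → ℤ) {m j : ℕ} (hj : j < k m) :
    spread k x j = partialSpread k x m j := by
  by_cases h : ∃ i, k i = j
  · obtain ⟨i, rfl⟩ := h
    rw [spread_apply hk, partialSpread_apply hk, if_pos (hk.lt_iff_lt.1 hj)]
  · push Not at h
    rw [spread_apply_of_notMem _ h, partialSpread_apply_of_notMem _ _ h]

theorem partialSpread_succ (k : ℕ → ℕ) (x : ℕ → ℤ) (m : ℕ) :
    partialSpread k x (m + 1) = partialSpread k x m + Finsupp.single (k m) (x m) :=
  Finset.sum_range_succ _ _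

end Spread

theorem ENNReal.tsum_eq_sum_range_add_tsum_Ico (f : ℕ → ℝ≥0∞) {l : ℕ → ℕ} (hl : StrictMono l) :
    ∑' i, f i = ∑ i ∈ Finset.range (l 0), f i +
      ∑' m, ∑ i ∈ Finset.Ico (l m) (l (m + 1)), f i := by
  have h1 := (ENNReal.tendsto_nat_tsum f).comp hl.tendsto_atTop
  have h2 := (ENNReal.tendsto_nat_tsum fun m => ∑ i ∈ Finset.Ico (l m) (l (m + 1)), f i).const_add
    (∑ i ∈ Finset.range (l 0), f i)
  refine tendsto_nhds_unique h1 (h2.congr fun M => ?_)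
  simp only [Function.comp_apply]
  induction M with
  | zero => simp
  | succ M ih =>
    rw [Finset.sum_range_succ, ← add_assoc, ih, Finset.sum_range_add_sum_Ico _ (hl M.lt_succ_self).le]

namespace LocalizableFamily

variable {C : Set (ℕ → ℤ)} {K : ℝ≥0∞} {h : ℕ → (ℕ → ℤ) → (ℕ → ℤ) → ℝ≥0∞}

theorem sum_le_of_four (H : LocalizableFamily C K h) (s : Finset ℕ) (p q r t : ℕ → ℤ) :
    ∑ i ∈ s, h i p t ≤ K * ∑ i ∈ s, h i p q +
      K * K * (∑ i ∈ s, h i q r + ∑ i ∈ s, h i t r) := by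
  rw [← Finset.sum_add_distrib, Finset.mul_sum, Finset.mul_sum, ← Finset.sum_add_distrib]
  refine Finset.sum_le_sum fun i _ => ?_
  calc h i p t ≤ K * (h i p q + h i q t) := H.triangle i p q t
    _ ≤ K * (h i p q + K * (h i q r + h i r t)) := by gcongr; exact H.triangle i q r t
    _ = _ := by rw [H.symm i r t]; ring

/-- Along a fast sequence of places `k` and over a suitable generic point `z`, the sums between two
points `z + spread k x` and `z + spread k y` split into blocks of coordinates: up to a summable
error, the `m`-th block depends on `x m` and `y m` only. -/
theorem exists_block_decomposition (H : LocalizableFamily C K h) {S : ℕ → Set ℕ}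
    (hS : ∀ m, (S m).Infinite) (P : ℕ → ℕ) :
    ∃ (k : ℕ → ℕ) (z : ℕ → ℤ) (block : ℕ → Finset ℕ), StrictMono k ∧ (∀ m, k m ∈ S m) ∧
      ∀ x y : ℕ → ℤ, (∀ m, 0 ≤ x m ∧ x m ≤ P (k m)) → (∀ m, 0 ≤ y m ∧ y m ≤ P (k m)) →
        (∑' i, h i (z + spread k x) (z + spread k y) ≠ ∞ ↔
          ∑' m, ∑ i ∈ block m,
            h i (z + spread k (Pi.single m (x m))) (z + spread k (Pi.single m (y m))) ≠ ∞) := by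
  obtain ⟨O, hO, hCO⟩ := H.isGδ.eq_iInter_nat
  have hOd : ∀ m, Dense (O m) := fun m =>
    H.dense.mono (by rw [hCO]; exact Set.iInter_subset _ m)
  set ε : ℕ → ℝ≥0∞ := fun m => 2⁻¹ ^ m with hε
  have hεpos : ∀ m, 0 < ε m := fun m => ENNReal.pow_pos (by simp) m
  have hεsum : ∑' m, ε m ≠ ∞ := by
    rw [hε, ENNReal.tsum_geometric]
    simp [ENNReal.one_sub_inv_two]
  choose zf kf lf hzf hLk hkS hlf hmem htail hhead using fun m (z : ℕ → ℤ) (L l₀ : ℕ) =>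
    H.exists_stage (finite_boxBelow P L) (hO m) (hOd m) (hεpos m) (hS m) z L l₀
  let F : ℕ → (ℕ → ℤ) × ℕ × ℕ → (ℕ → ℤ) × ℕ × ℕ := fun m s =>
    (zf m s.1 s.2.1 s.2.2, kf m s.1 s.2.1 s.2.2, lf m s.1 s.2.1 s.2.2)
  let st : ℕ → (ℕ → ℤ) × ℕ × ℕ := fun m =>
    Nat.rec (F 0 (0, 0, 0)) (fun m s => F (m + 1) (s.1, s.2.1 + 1, s.2.2)) m
  -- the `m`-th stage extends the cylinder of length `L m` around `zp m`
  let zp : ℕ → ℕ → ℤ := fun m => Nat.casesOn m 0 fun m => (st m).1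
  let L : ℕ → ℕ := fun m => Nat.casesOn m 0 fun m => (st m).2.1 + 1
  let lp : ℕ → ℕ := fun m => Nat.casesOn m 0 fun m => (st m).2.2
  have hst : ∀ m, st m = F m (zp m, L m, lp m) := by
    intro m
    cases m <;> rfl
  let k : ℕ → ℕ := fun m => (st m).2.1
  let l : ℕ → ℕ := fun m => (st m).2.2
  let Z : ℕ → ℕ → ℤ := fun m => (st m).1
  have hk' : ∀ m, k m = kf m (zp m) (L m) (lp m) := fun m => by simp only [k, hst m, F]
  have hl' : ∀ m, l m = lf m (zp m) (L m) (lp m) := fun m => by simp only [l, hst m, F]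
  have hZ' : ∀ m, Z m = zf m (zp m) (L m) (lp m) := fun m => by simp only [Z, hst m, F]
  have hLk' : ∀ m, L m ≤ k m := fun m => by rw [hk']; exact hLk _ _ _ _
  have hk : StrictMono k := strictMono_nat_of_lt_succ fun m => hLk' (m + 1)
  have hl : StrictMono l := strictMono_nat_of_lt_succ fun m => by
    rw [hl' (m + 1)]; exact hlf (m + 1) _ _ _
  have hZstep : ∀ m, Z (m + 1) ∈ cylinder (Z m) (k m + 1) := fun m => by
    rw [hZ' (m + 1)]; exact hzf (m + 1) _ _ _
  have hZle : ∀ m m', m ≤ m' → Z m' ∈ cylinder (Z m) (k m + 1) := by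
    intro m m' hmm
    induction m', hmm using Nat.le_induction with
    | base => exact self_mem_cylinder _ _
    | succ m' hmm ih =>
      intro j hj
      rw [← ih j hj]
      exact hZstep m' j (lt_of_lt_of_le hj (Nat.succ_le_succ (hk.monotone hmm)))
  -- the generic point
  let z : ℕ → ℤ := fun j => Z j j
  have hz : ∀ m, z ∈ cylinder (Z m) (k m) := by
    intro m j hj
    rcases le_total m j with hmj | hmj
    · exact hZle m j hmj j (by omega)
    · exact (hZle j m hmj j (Nat.lt_succ_of_le hk.le_apply)).symm
  have hmem' : ∀ m, ∀ g ∈ boxBelow P (L m), ∀ w ∈ cylinder (Z m) (k m), ⇑g + w ∈ O m := by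
    intro m
    rw [hZ', hk']
    exact hmem _ _ _ _
  have htail' : ∀ m, ∀ w ∈ cylinder (Z m) (k m) ∩ C, ∀ g ∈ boxBelow P (L m),
      ∀ g' ∈ boxBelow P (L m), ∑' i, h (i + l m) (⇑g + w) (⇑g' + w) ≤ ε m := by
    intro m
    rw [hZ', hk', hl']
    exact htail _ _ _ _
  have hhead' : ∀ m, ∀ g ∈ boxBelow P (L m), ∀ w ∈ cylinder (Z m) (k m) ∩ C,
      ∀ w' ∈ cylinder (Z m) (k m) ∩ C,
      ∑ i ∈ Finset.range (l m), h i (⇑g + w) (⇑g + w') ≤ ε m := by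
    intro m
    rw [hZ', hk', hl']
    exact hhead _ _ _ _
  have hbox0 : ∀ m, (0 : ℕ →₀ ℤ) ∈ boxBelow P (L m) := fun m => by simp [boxBelow]
  have hboxP : ∀ x : ℕ → ℤ, (∀ m, 0 ≤ x m ∧ x m ≤ P (k m)) → ∀ m,
      partialSpread k x m ∈ boxBelow P (L m) := by
    intro x hx m
    refine ⟨fun j hj => ?_, fun j => ?_⟩
    · by_cases h : ∃ i, k i = j
      · obtain ⟨i, rfl⟩ := h
        rw [partialSpread_apply hk, if_neg]
        intro him
        cases m with
        | zero => omega
        | succ m =>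
          have h1 : k m + 1 ≤ k i := hj
          have := hk.lt_iff_lt.1 (Nat.lt_of_succ_le h1)
          omega
      · push Not at h
        exact partialSpread_apply_of_notMem _ _ h
    · by_cases h : ∃ i, k i = j
      · obtain ⟨i, rfl⟩ := h
        rw [partialSpread_apply hk]
        split_ifs
        · exact hx i
        · simp
      · push Not at h
        rw [partialSpread_apply_of_notMem _ _ h]
        simp
  -- splitting off the first `m` places leaves a point of the `m`-th cylinder
  have hrest : ∀ (x : ℕ → ℤ) (m : ℕ),
      z + spread k x - ⇑(partialSpread k x m) ∈ cylinder (Z m) (k m) := by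
    intro x m j hj
    rw [Pi.sub_apply, Pi.add_apply, spread_apply_of_lt hk x hj, add_sub_cancel_right]
    exact hz m j hj
  have hC : ∀ x : ℕ → ℤ, (∀ m, 0 ≤ x m ∧ x m ≤ P (k m)) → z + spread k x ∈ C := by
    intro x hx
    rw [hCO]
    refine Set.mem_iInter.2 fun m => ?_
    have := hmem' m _ (hboxP x hx m) _ (hrest x m)
    rwa [add_sub_cancel] at this
  have hrestC : ∀ x : ℕ → ℤ, (∀ m, 0 ≤ x m ∧ x m ≤ P (k m)) → ∀ m,
      z + spread k x - ⇑(partialSpread k x m) ∈ cylinder (Z m) (k m) ∩ C := by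
    intro x hx m
    refine ⟨hrest x m, ?_⟩
    have := H.add_mem (-partialSpread k x m) _ (hC x hx)
    rwa [Finsupp.coe_neg, neg_add_eq_sub] at this
  have hbnd0 : ∀ m, 0 ≤ (0 : ℕ → ℤ) m ∧ (0 : ℕ → ℤ) m ≤ P (k m) := fun m => by simp
  have hzC : z ∈ C := by
    have := hC 0 hbnd0
    rwa [spread_zero, add_zero] at this
  have hblock : ∀ x : ℕ → ℤ, (∀ m, 0 ≤ x m ∧ x m ≤ P (k m)) → ∀ m,
      ∑ i ∈ Finset.Ico (l m) (l (m + 1)),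
        h i (z + spread k x) (z + spread k (Pi.single m (x m))) ≤ K * (ε (m + 1) + ε m) := by
    intro x hx m
    have hsingle : ∀ i, 0 ≤ (Pi.single m (x m) : ℕ → ℤ) i ∧
        (Pi.single m (x m) : ℕ → ℤ) i ≤ P (k i) := by
      intro i
      rcases eq_or_ne i m with rfl | him
      · simpa using hx i
      · simp [Pi.single_eq_of_ne him]
    -- the intermediate point has the same head as `z + spread k x`, by `hhead'`, and the same tail
    -- as the point which carries `x m` alone, by `htail'`
    set t : ℕ → ℤ := z + ⇑(partialSpread k x (m + 1)) with ht
    have e1 : ∑ i ∈ Finset.Ico (l m) (l (m + 1)), h i (z + spread k x) t ≤ ε (m + 1) := by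
      have := hhead' (m + 1) _ (hboxP x hx (m + 1)) _ (hrestC x hx (m + 1)) z ⟨hz (m + 1), hzC⟩
      rw [add_sub_cancel, add_comm _ z] at this
      refine le_trans (Finset.sum_le_sum_of_subset ?_) this
      intro i hi
      exact Finset.mem_range.2 (Finset.mem_Ico.1 hi).2
    have e2 : ∑ i ∈ Finset.Ico (l m) (l (m + 1)), h i t (z + spread k (Pi.single m (x m))) ≤
        ε m := by
      have hw : z + spread k (Pi.single m (x m)) ∈ cylinder (Z m) (k m) ∩ C := by
        refine ⟨fun j hj => ?_, hC _ hsingle⟩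
        rw [Pi.add_apply, spread_single hk, Finsupp.single_eq_of_ne (by omega), add_zero]
        exact hz m j hj
      have := htail' m _ hw _ (hboxP x hx m) 0 (hbox0 m)
      have ht' : ⇑(partialSpread k x m) + (z + spread k (Pi.single m (x m))) = t := by
        rw [ht, partialSpread_succ, Finsupp.coe_add, spread_single hk]
        abel
      rw [ht', Finsupp.coe_zero, zero_add] at this
      refine le_trans ?_ this
      rw [Finset.sum_Ico_eq_sum_range]
      simp only [add_comm (l m)]
      exact ENNReal.sum_le_tsum _
    calc _ ≤ ∑ i ∈ Finset.Ico (l m) (l (m + 1)),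
          K * (h i (z + spread k x) t + h i t (z + spread k (Pi.single m (x m)))) :=
          Finset.sum_le_sum fun i _ => H.triangle i _ _ _
      _ ≤ K * (ε (m + 1) + ε m) := by
          rw [← Finset.mul_sum, Finset.sum_add_distrib]
          gcongr
  have herr : ∑' m, K * (ε (m + 1) + ε m) ≠ ∞ := by
    rw [ENNReal.tsum_mul_left, ENNReal.tsum_add]
    refine ENNReal.mul_ne_top H.const_ne_top (ENNReal.add_ne_top.2 ⟨?_, hεsum⟩)
    exact ne_top_of_le_ne_top hεsum
      (ENNReal.tsum_comp_le_tsum_of_injective (add_left_injective 1) ε)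
  -- comparison of two block sums which agree up to the errors of `hblock`
  have hcompare : ∀ A B : ℕ → ℝ≥0∞, (∀ m, A m ≤ K * (K * (ε (m + 1) + ε m)) +
      K * K * (B m + K * (ε (m + 1) + ε m))) → ∑' m, B m ≠ ∞ → ∑' m, A m ≠ ∞ := by
    intro A B hAB hB
    refine ne_top_of_le_ne_top ?_ (ENNReal.tsum_le_tsum hAB)
    rw [ENNReal.tsum_add, ENNReal.tsum_mul_left, ENNReal.tsum_mul_left (a := K * K),
      ENNReal.tsum_add]
    exact ENNReal.add_ne_top.2 ⟨ENNReal.mul_ne_top H.const_ne_top herr,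
      ENNReal.mul_ne_top (ENNReal.mul_ne_top H.const_ne_top H.const_ne_top)
        (ENNReal.add_ne_top.2 ⟨hB, herr⟩)⟩
  refine ⟨k, z, fun m => Finset.Ico (l m) (l (m + 1)), hk,
    fun m => by rw [hk']; exact hkS _ _ _ _, fun x y hx hy => ?_⟩
  have hfirst : ∑ i ∈ Finset.range (l 0), h i (z + spread k x) (z + spread k y) ≠ ∞ := by
    have := hhead' 0 0 (hbox0 0) _ (hrestC x hx 0) _ (hrestC y hy 0)
    simp only [partialSpread, Finset.range_zero, Finset.sum_empty, Finsupp.coe_zero, sub_zero,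
      zero_add] at this
    exact ne_top_of_le_ne_top (by simp [hε]) this
  rw [ENNReal.tsum_eq_sum_range_add_tsum_Ico _ hl, ENNReal.add_ne_top, and_iff_right hfirst]
  constructor
  · refine hcompare _ _ fun m => (H.sum_le_of_four _ _ (z + spread k x) (z + spread k y) _).trans ?_
    have e1 := hblock x hx m
    have e2 := hblock y hy m
    simp only [H.symm _ (z + spread k (Pi.single m (x m))) (z + spread k x),
      H.symm _ (z + spread k (Pi.single m (y m))) (z + spread k y)]
    gcongr
  · refine hcompare _ _ fun m => (H.sum_le_of_four _ _ (z + spread k (Pi.single m (x m)))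
      (z + spread k (Pi.single m (y m))) _).trans ?_
    have e1 := hblock x hx m
    have e2 := hblock y hy m
    gcongr

end LocalizableFamily

/-! ### Weighted sums of powers -/

/-- The weighted power `c |a - b| ^ t` of a distance of reals, as an extended nonnegative real. -/
noncomputable def powTerm (c : ℝ≥0∞) (t a b : ℝ) : ℝ≥0∞ := c * ‖a - b‖ₑ ^ t

theorem powTerm_self (c : ℝ≥0∞) {t : ℝ} (ht : 1 ≤ t) (a : ℝ) : powTerm c t a a = 0 := by
  simp [powTerm, ENNReal.zero_rpow_of_pos (zero_lt_one.trans_le ht)]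

theorem powTerm_symm (c : ℝ≥0∞) (t a b : ℝ) : powTerm c t a b = powTerm c t b a := by
  rw [powTerm, powTerm, ← enorm_neg, neg_sub]

theorem powTerm_triangle (c : ℝ≥0∞) {t T : ℝ} (ht : 1 ≤ t) (hT : t ≤ T) (a b e : ℝ) :
    powTerm c t a e ≤ 2 ^ T * (powTerm c t a b + powTerm c t b e) := by
  have h1 : ‖a - e‖ₑ ≤ ‖a - b‖ₑ + ‖b - e‖ₑ := by
    rw [← sub_add_sub_cancel a b e]; exact enorm_add_le _ _
  have h2 : ‖a - e‖ₑ ^ t ≤ 2 ^ T * (‖a - b‖ₑ ^ t + ‖b - e‖ₑ ^ t) :=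
    calc ‖a - e‖ₑ ^ t ≤ (‖a - b‖ₑ + ‖b - e‖ₑ) ^ t :=
          ENNReal.rpow_le_rpow h1 (zero_le_one.trans ht)
      _ ≤ 2 ^ (t - 1) * (‖a - b‖ₑ ^ t + ‖b - e‖ₑ ^ t) :=
          ENNReal.rpow_add_le_mul_rpow_add_rpow _ _ ht
      _ ≤ _ := by
          gcongr
          · norm_num
          · linarith
  calc powTerm c t a e ≤ c * (2 ^ T * (‖a - b‖ₑ ^ t + ‖b - e‖ₑ ^ t)) := by
        unfold powTerm; gcongr
    _ = _ := by unfold powTerm; ring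

/-- Along a chain of `N` steps, the `t`-th power of the distance grows by at most the factor
`N ^ (t - 1)` over the sum of the `t`-th powers of the steps. -/
theorem powTerm_chain_le (c : ℝ≥0∞) {t : ℝ} (ht : 1 ≤ t) (f : ℕ → ℝ) (N : ℕ) :
    powTerm c t (f 0) (f N) ≤
      (N : ℝ≥0∞) ^ (t - 1) * ∑ a ∈ Finset.range N, powTerm c t (f a) (f (a + 1)) := by
  have h1 : ‖f 0 - f N‖ₑ ≤ ∑ a ∈ Finset.range N, ‖f a - f (a + 1)‖ₑ := by
    rw [← Finset.sum_range_sub']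
    exact enorm_sum_le _ _
  have h2 := ENNReal.rpow_sum_le_const_mul_sum_rpow (Finset.range N)
    (fun a => ‖f a - f (a + 1)‖ₑ) ht
  rw [Finset.card_range] at h2
  calc powTerm c t (f 0) (f N)
      ≤ c * ((N : ℝ≥0∞) ^ (t - 1) * ∑ a ∈ Finset.range N, ‖f a - f (a + 1)‖ₑ ^ t) := by
        unfold powTerm
        gcongr
        exact (ENNReal.rpow_le_rpow h1 (zero_le_one.trans ht)).trans h2
    _ = _ := by
        unfold powTerm
        rw [← Finset.mul_sum]
        ring

/-- The equivalence relation on real families under which `x` and `y` are related when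
`∑ i, c i * |x i - y i| ^ t i` is finite, for exponents `t i` in a bounded part of `[1, ∞)`. -/
noncomputable def powSumSetoid {ι : Type*} (c : ι → ℝ≥0∞) (t : ι → ℝ) (T : ℝ) (h1 : ∀ i, 1 ≤ t i)
    (hT : ∀ i, t i ≤ T) : Setoid (ι → ℝ) where
  r x y := ∑' i, powTerm (c i) (t i) (x i) (y i) ≠ ∞
  iseqv :=
    { refl := fun x => by simp [powTerm_self _ (h1 _)]
      symm := fun {x y} h => by
        simpa only [powTerm_symm _ _ (y _)] using h
      trans := fun {x y z} hxy hyz => by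
        refine ne_top_of_le_ne_top ?_ (ENNReal.tsum_le_tsum fun i =>
          powTerm_triangle (c i) (h1 i) (hT i) (x i) (y i) (z i))
        rw [ENNReal.tsum_mul_left, ENNReal.tsum_add]
        exact ENNReal.mul_ne_top (by simp) (ENNReal.add_ne_top.2 ⟨hxy, hyz⟩) }

/-- A sequence of exponents `t n` decreasing strictly above `p`, and of weights `2⁻¹ ^ d n` which
decrease so fast that the different scales do not interact. The numbers `N n` (of steps) and `R n`
(of copies) witness that the powers `t n` and `t (n + 1)` differ noticeably at the `n`-th scale: the
weighted `t n`-th power of `N n`, taken `R n` times, is at least `1`, whereas the weighted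
`t (n + 1)`-th powers are summable. -/
structure Scales (p : ℝ) where
  /-- the exponents -/
  t : ℕ → ℝ
  /-- the binary orders of the weights -/
  d : ℕ → ℕ
  /-- the numbers of steps -/
  N : ℕ → ℕ
  /-- the numbers of copies -/
  R : ℕ → ℕ
  one_le : 1 ≤ p
  strictAnti : StrictAnti t
  le_t : ∀ n, p ≤ t n
  add_le_d : ∀ m n, m < n → d m + n ≤ d n
  N_pos : ∀ n, 0 < N n
  one_le_mul : ∀ n, 1 ≤ (R n : ℝ≥0∞) * (2⁻¹ ^ d n * (N n : ℝ≥0∞) ^ t n)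
  mul_le : ∀ n, (R n : ℝ≥0∞) * (2⁻¹ ^ d n * (N n : ℝ≥0∞) ^ t (n + 1)) ≤ 2 * 2⁻¹ ^ n

namespace Scales

variable {p : ℝ} (σ : Scales p)

theorem p_le_t_zero : p ≤ σ.t 0 := σ.le_t 0

theorem t_le (n : ℕ) : σ.t n ≤ σ.t 0 := σ.strictAnti.antitone n.zero_le

/-- The weight of a coordinate: `1` on the real coordinates, `2⁻¹ ^ d (a k)` on the integer
coordinates `(k, c)`. -/
noncomputable def weight (a : ℕ → ℕ) : ℕ ⊕ ℕ × ℕ → ℝ≥0∞ :=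
  Sum.elim (fun _ => 1) fun s => 2⁻¹ ^ σ.d (a s.1)

/-- The exponent of a coordinate: `p` on the real coordinates, `t (a k)` on the integer
coordinates `(k, c)`. -/
def exponent (a : ℕ → ℕ) : ℕ ⊕ ℕ × ℕ → ℝ :=
  Sum.elim (fun _ => p) fun s => σ.t (a s.1)

theorem le_exponent (a : ℕ → ℕ) (i : ℕ ⊕ ℕ × ℕ) : p ≤ σ.exponent a i := by
  rcases i with i | s
  · exact le_rfl
  · exact σ.le_t _

theorem one_le_exponent (a : ℕ → ℕ) (i : ℕ ⊕ ℕ × ℕ) : 1 ≤ σ.exponent a i :=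
  σ.one_le.trans (σ.le_exponent a i)

theorem exponent_le (a : ℕ → ℕ) (i : ℕ ⊕ ℕ × ℕ) : σ.exponent a i ≤ σ.t 0 := by
  rcases i with i | s
  · exact σ.p_le_t_zero
  · exact σ.t_le _

theorem weight_ne_top (a : ℕ → ℕ) (i : ℕ ⊕ ℕ × ℕ) : σ.weight a i ≠ ∞ := by
  rcases i with i | s
  · simp [weight]
  · simp [weight]

end Scales

/-- The coordinates of a pair consisting of a real sequence and a double sequence of integers, as
reals. -/
def mixedCoords (x : (ℕ → ℝ) × (ℕ × ℕ → ℤ)) : ℕ ⊕ ℕ × ℕ → ℝ :=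
  Sum.elim x.1 fun s => (x.2 s : ℝ)

theorem measurable_mixedCoords_apply (i : ℕ ⊕ ℕ × ℕ) :
    Measurable fun x : (ℕ → ℝ) × (ℕ × ℕ → ℤ) => mixedCoords x i := by
  rcases i with i | s
  · exact (measurable_pi_apply i).comp measurable_fst
  · exact (measurable_of_countable fun n : ℤ => (n : ℝ)).comp
      ((measurable_pi_apply s).comp measurable_snd)

namespace Scales

variable {p : ℝ} (σ : Scales p)

/-- The sum which defines the equivalence relation `σ.rel a`. -/
noncomputable def powSum (a : ℕ → ℕ) (x y : (ℕ → ℝ) × (ℕ × ℕ → ℤ)) : ℝ≥0∞ :=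
  ∑' i, powTerm (σ.weight a i) (σ.exponent a i) (mixedCoords x i) (mixedCoords y i)

theorem measurable_powSum (a : ℕ → ℕ) :
    Measurable fun z : ((ℕ → ℝ) × (ℕ × ℕ → ℤ)) × ((ℕ → ℝ) × (ℕ × ℕ → ℤ)) =>
      σ.powSum a z.1 z.2 := by
  refine Measurable.tsum fun i => ?_
  unfold powTerm
  exact ((((measurable_mixedCoords_apply i).comp measurable_fst).sub
    ((measurable_mixedCoords_apply i).comp measurable_snd)).enorm.pow_const _).const_mul _

/-- The equivalence relation on `ℝ^ω × ℤ^(ω × ω)` which adds to `ℓ_p` on the real coordinates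
infinitely many copies, for each `k`, of the weighted power `2⁻¹ ^ d (a k) |u - v| ^ t (a k)` of the
distance on `ℤ`. -/
noncomputable def rel (a : ℕ → ℕ) : BorelEquivRel where
  carrier := (ℕ → ℝ) × (ℕ × ℕ → ℤ)
  rel := (powSumSetoid (σ.weight a) (σ.exponent a) (σ.t 0) (σ.one_le_exponent a)
    (σ.exponent_le a)).comap mixedCoords
  measurableSet_rel :=
    (σ.measurable_powSum a) (measurableSet_singleton ∞).compl

theorem rel_iff (a : ℕ → ℕ) (x y : (ℕ → ℝ) × (ℕ × ℕ → ℤ)) :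
    (σ.rel a).rel x y ↔ σ.powSum a x y ≠ ∞ := Iff.rfl

end Scales

/-! ### Growth of distances along chains -/

/-- If `n` is not a value of `b`, then along chains of `N` steps of size at most `2 ^ M * 2⁻¹ ^ d n`
with `M < n`, every coordinate of `σ.rel b` grows at most like the power `t (n + 1)`: the
coordinates with a larger exponent are integer valued and of such a weight that they cannot change
in one step. -/
theorem Scales.powTerm_chain_le_of_notMem_range {p : ℝ} (σ : Scales p) {b : ℕ → ℕ} {n M : ℕ}
    (hn : n ∉ Set.range b) (hM : M < n) {N : ℕ} (hN : 0 < N) (f : ℕ → (ℕ → ℝ) × (ℕ × ℕ → ℤ))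
    (i : ℕ ⊕ ℕ × ℕ)
    (hstep : ∀ a < N, powTerm (σ.weight b i) (σ.exponent b i) (mixedCoords (f a) i)
      (mixedCoords (f (a + 1)) i) ≤ 2 ^ M * 2⁻¹ ^ σ.d n) :
    powTerm (σ.weight b i) (σ.exponent b i) (mixedCoords (f 0) i) (mixedCoords (f N) i) ≤
      (N : ℝ≥0∞) ^ (σ.t (n + 1) - 1) * ∑ a ∈ Finset.range N,
        powTerm (σ.weight b i) (σ.exponent b i) (mixedCoords (f a) i)
          (mixedCoords (f (a + 1)) i) := by
  by_cases he : σ.exponent b i ≤ σ.t (n + 1)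
  · refine (powTerm_chain_le _ (σ.one_le_exponent b i) (fun a => mixedCoords (f a) i) N).trans ?_
    gcongr
    exact_mod_cast hN
  · rcases i with i | s
    · exact absurd (σ.le_t (n + 1)) he
    · have hlt : b s.1 < n := by
        rcases lt_trichotomy (b s.1) n with h | h | h
        · exact h
        · exact absurd ⟨_, h⟩ hn
        · exact absurd (σ.strictAnti.antitone (Nat.succ_le_of_lt h)) he
      have hconst : ∀ a ≤ N, (f a).2 s = (f 0).2 s := by
        intro a
        induction a with
        | zero => simp
        | succ a ih =>
          intro ha
          rw [← ih (by omega)]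
          by_contra hne
          have h1 := hstep a ha
          have h2 : (1 : ℝ≥0∞) ≤ ‖((f a).2 s : ℝ) - ((f (a + 1)).2 s : ℝ)‖ₑ ^
              σ.exponent b (Sum.inr s) := by
            refine ENNReal.one_le_rpow ?_ (zero_lt_one.trans_le (σ.one_le_exponent b _))
            rw [← ofReal_norm, ENNReal.one_le_ofReal, Real.norm_eq_abs]
            have : (1 : ℤ) ≤ |(f a).2 s - (f (a + 1)).2 s| :=
              Int.one_le_abs (sub_ne_zero.2 (Ne.symm hne))
            exact_mod_cast this
          have h3 : (2⁻¹ : ℝ≥0∞) ^ σ.d (b s.1) ≤ 2 ^ M * 2⁻¹ ^ σ.d n :=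
            by
            refine le_trans ?_ h1
            have h5 := mul_le_mul_right h2 ((2⁻¹ : ℝ≥0∞) ^ σ.d (b s.1))
            rwa [mul_one] at h5
          have h4 : (2 : ℝ≥0∞) ^ M * 2⁻¹ ^ σ.d n < 2⁻¹ ^ σ.d (b s.1) := by
            obtain ⟨e, he⟩ : ∃ e, σ.d n = M + (e + 1 + σ.d (b s.1)) :=
              ⟨σ.d n - M - 1 - σ.d (b s.1), by have := σ.add_le_d _ _ hlt; omega⟩
            rw [he, pow_add, ← mul_assoc, ← mul_pow, ENNReal.mul_inv_cancel (by simp) (by simp),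
              one_pow, one_mul, pow_add]
            calc (2⁻¹ : ℝ≥0∞) ^ (e + 1) * 2⁻¹ ^ σ.d (b s.1) < 1 * 2⁻¹ ^ σ.d (b s.1) := by
                  refine ENNReal.mul_lt_mul_left (by simp) (by simp) ?_
                  exact pow_lt_one' (by simp) (by simp)
              _ = _ := one_mul _
          exact absurd (h3.trans_lt h4) (lt_irrefl _)
      have : mixedCoords (f N) (Sum.inr s) = mixedCoords (f 0) (Sum.inr s) := by
        simp [mixedCoords, hconst N le_rfl]
      rw [this, powTerm_self _ (σ.one_le_exponent b _)]
      exact zero_le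

/-! ### Selection of coordinates -/

theorem exists_pairwise_disjoint_finset_card {S : ℕ → Set ℕ} (hS : ∀ r, (S r).Infinite)
    (R : ℕ → ℕ) : ∃ J : ℕ → Finset ℕ, (∀ r, ↑(J r) ⊆ S r) ∧ (∀ r, (J r).card = R r) ∧
      Pairwise fun r s => Disjoint (J r) (J s) := by
  have key : ∀ (r : ℕ) (A : Finset ℕ), ∃ B : Finset ℕ, ↑B ⊆ S r ∧ B.card = R r ∧ Disjoint A B := by
    intro r A
    obtain ⟨B, hB, hc⟩ := ((hS r).sdiff A.finite_toSet).exists_subset_card_eq (R r)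
    refine ⟨B, fun x hx => (hB hx).1, hc, Finset.disjoint_left.2 fun x hxA hxB => (hB hxB).2 hxA⟩
  choose B hBS hBc hBd using key
  let A : ℕ → Finset ℕ := fun r => Nat.rec ∅ (fun r A => A ∪ B r A) r
  have hA : ∀ r s, r < s → B r (A r) ⊆ A s := by
    intro r s hrs
    induction s, hrs using Nat.le_induction with
    | base => exact Finset.subset_union_right
    | succ s _ ih => exact ih.trans Finset.subset_union_left
  refine ⟨fun r => B r (A r), fun r => hBS _ _, fun r => hBc _ _, ?_⟩
  have hlt : ∀ r s, r < s → Disjoint (B r (A r)) (B s (A s)) := fun r s hrs =>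
    (hBd s (A s)).mono_left (hA r s hrs)
  intro r s hrs
  rcases hrs.lt_or_gt with h | h
  · exact hlt r s h
  · exact (hlt s r h).symm

theorem ENNReal.tsum_eq_tsum_sum_of_pairwise_disjoint {J : ℕ → Finset ℕ}
    (hJ : Pairwise fun r s => Disjoint (J r) (J s)) {f : ℕ → ℝ≥0∞}
    (hf : ∀ m, (∀ r, m ∉ J r) → f m = 0) : ∑' m, f m = ∑' r, ∑ m ∈ J r, f m := by
  classical
  have h1 : ∀ r, ∑ m ∈ J r, f m = ∑' m, if m ∈ J r then f m else 0 := fun r => by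
    rw [tsum_eq_sum (s := J r) (fun m hm => if_neg hm)]
    exact Finset.sum_congr rfl fun m hm => (if_pos hm).symm
  simp only [h1]
  rw [ENNReal.tsum_comm]
  refine tsum_congr fun m => ?_
  by_cases hm : ∃ r, m ∈ J r
  · obtain ⟨r, hr⟩ := hm
    rw [tsum_eq_single r, if_pos hr]
    intro s hs
    exact if_neg fun h => Finset.disjoint_left.1 (hJ hs) h hr
  · push Not at hm
    simp [hf m hm, hm]

/-- The combinatorial core of non-reducibility. In each `W m` a single step can cost at most a
constant times its cost `2⁻¹ ^ d (ν r)` in the domain, outside finitely many `m` for each large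
`r`, since otherwise many expensive steps would be cheap in the domain. Then `N` steps, taken in
`R` copies, cost too little in the target. -/
theorem Scales.false_of_additive {p : ℝ} (σ : Scales p) {ν : ℕ → ℕ} (hν : StrictMono ν)
    {W : ℕ → ℤ → ℤ → ℝ≥0∞} (hW0 : ∀ m, W m 0 0 = 0)
    (hgrow : ∀ m M, M < ν m.unpair.1 →
      (∀ a < σ.N (ν m.unpair.1), W m a (a + 1) ≤ 2 ^ M * 2⁻¹ ^ σ.d (ν m.unpair.1)) →
      W m 0 (σ.N (ν m.unpair.1)) ≤ (σ.N (ν m.unpair.1) : ℝ≥0∞) ^ σ.t (ν m.unpair.1 + 1) *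
        (2 ^ M * 2⁻¹ ^ σ.d (ν m.unpair.1)))
    (hiff : ∀ x y : ℕ → ℤ, (∀ m, 0 ≤ x m ∧ x m ≤ σ.N (ν m.unpair.1)) →
      (∀ m, 0 ≤ y m ∧ y m ≤ σ.N (ν m.unpair.1)) →
      (∑' m, powTerm (2⁻¹ ^ σ.d (ν m.unpair.1)) (σ.t (ν m.unpair.1)) (x m) (y m) ≠ ∞ ↔
        ∑' m, W m (x m) (y m) ≠ ∞)) : False := by
  classical
  have hcopies : ∀ r, {m : ℕ | m.unpair.1 = r}.Infinite := fun r => by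
    refine Set.infinite_of_injective_forall_mem (f := fun c => Nat.pair r c) ?_ ?_
    · intro c c' h
      exact (Nat.pair_eq_pair.1 h).2
    · intro c
      simp
  have ht1 : ∀ n, 1 ≤ σ.t n := fun n => σ.one_le.trans (σ.le_t n)
  have hbounded : ∃ M, ∀ r, M ≤ r → {m : ℕ | m.unpair.1 = r ∧ ∃ a < σ.N (ν r),
      2 ^ M * 2⁻¹ ^ σ.d (ν r) < W m a (a + 1)}.Finite := by
    by_contra hcon
    push Not at hcon
    choose r hMr hr using hcon
    -- `2 ^ (d - M)` expensive steps cost `2⁻¹ ^ M` in the domain, but at least `1` in the target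
    have hd : ∀ M, M ≤ σ.d (ν (r M)) := by
      intro M
      have h1 : M ≤ ν (r M) := (hMr M).trans hν.le_apply
      rcases Nat.eq_zero_or_pos (ν (r M)) with h0 | h0
      · omega
      · have := σ.add_le_d _ _ h0
        omega
    obtain ⟨J, hJS, hJc, hJd⟩ :=
      exists_pairwise_disjoint_finset_card hr fun M => 2 ^ (σ.d (ν (r M)) - M)
    have hex : ∀ m, ∃ a : ℕ, ∀ M, m ∈ J M → a < σ.N (ν (r M)) ∧
        2 ^ M * 2⁻¹ ^ σ.d (ν (r M)) < W m a (a + 1) := by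
      intro m
      by_cases hm : ∃ M, m ∈ J M
      · obtain ⟨M, hM⟩ := hm
        obtain ⟨-, a, ha, haW⟩ := hJS M hM
        refine ⟨a, fun M' hM' => ?_⟩
        obtain rfl : M' = M := by
          by_contra hne
          exact Finset.disjoint_left.1 (hJd hne) hM' hM
        exact ⟨ha, haW⟩
      · push Not at hm
        exact ⟨0, fun M hM => absurd hM (hm M)⟩
    choose a ha using hex
    let x : ℕ → ℤ := fun m => if ∃ M, m ∈ J M then a m else 0
    let y : ℕ → ℤ := fun m => if ∃ M, m ∈ J M then a m + 1 else 0
    have hxJ : ∀ M, ∀ m ∈ J M, x m = a m := fun M m hm => if_pos ⟨M, hm⟩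
    have hyJ : ∀ M, ∀ m ∈ J M, y m = a m + 1 := fun M m hm => if_pos ⟨M, hm⟩
    have hx0 : ∀ m, (∀ M, m ∉ J M) → x m = 0 := fun m hm => if_neg (by push Not; exact hm)
    have hy0 : ∀ m, (∀ M, m ∉ J M) → y m = 0 := fun m hm => if_neg (by push Not; exact hm)
    have hbd : ∀ m, (0 ≤ x m ∧ x m ≤ σ.N (ν m.unpair.1)) ∧
        (0 ≤ y m ∧ y m ≤ σ.N (ν m.unpair.1)) := by
      intro m
      by_cases hm : ∃ M, m ∈ J M
      · obtain ⟨M, hM⟩ := hm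
        have h1 := (ha m M hM).1
        have h2 : m.unpair.1 = r M := (hJS M hM).1
        rw [hxJ M m hM, hyJ M m hM, h2]
        omega
      · push Not at hm
        rw [hx0 m hm, hy0 m hm]
        omega
    have hpow : ∀ M, ((2 ^ (σ.d (ν (r M)) - M) : ℕ) : ℝ≥0∞) * 2⁻¹ ^ σ.d (ν (r M)) = 2⁻¹ ^ M := by
      intro M
      obtain ⟨e, he⟩ : ∃ e, σ.d (ν (r M)) = e + M := ⟨σ.d (ν (r M)) - M, by have := hd M; omega⟩
      rw [he, Nat.add_sub_cancel, pow_add, ← mul_assoc, Nat.cast_pow, Nat.cast_ofNat, ← mul_pow,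
        ENNReal.mul_inv_cancel (by simp) (by simp), one_pow, one_mul]
    have hU : ∑' m, powTerm (2⁻¹ ^ σ.d (ν m.unpair.1)) (σ.t (ν m.unpair.1)) (x m) (y m) ≠ ∞ := by
      rw [ENNReal.tsum_eq_tsum_sum_of_pairwise_disjoint hJd]
      · have : ∀ M, ∑ m ∈ J M, powTerm (2⁻¹ ^ σ.d (ν m.unpair.1)) (σ.t (ν m.unpair.1))
            (x m) (y m) = 2⁻¹ ^ M := by
          intro M
          rw [← hpow M, ← hJc M, ← nsmul_eq_mul, ← Finset.sum_const]
          refine Finset.sum_congr rfl fun m hm => ?_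
          have h2 : m.unpair.1 = r M := (hJS M hm).1
          rw [hxJ M m hm, hyJ M m hm, h2]
          simp [powTerm]
        simp only [this]
        rw [ENNReal.tsum_geometric]
        simp [ENNReal.one_sub_inv_two]
      · intro m hm
        rw [hx0 m hm, hy0 m hm, powTerm_self _ (ht1 _)]
    refine (hiff x y (fun m => (hbd m).1) (fun m => (hbd m).2)).1 hU ?_
    rw [ENNReal.tsum_eq_tsum_sum_of_pairwise_disjoint hJd]
    · refine top_unique ?_
      rw [← ENNReal.tsum_const_eq_top_of_ne_zero (α := ℕ) (one_ne_zero (α := ℝ≥0∞))]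
      refine ENNReal.tsum_le_tsum fun M => ?_
      calc (1 : ℝ≥0∞) = 2 ^ M * 2⁻¹ ^ M := by
            rw [← mul_pow, ENNReal.mul_inv_cancel (by simp) (by simp), one_pow]
        _ = ∑ m ∈ J M, 2 ^ M * 2⁻¹ ^ σ.d (ν (r M)) := by
            rw [Finset.sum_const, hJc, nsmul_eq_mul, mul_left_comm, hpow]
        _ ≤ _ := by
            refine Finset.sum_le_sum fun m hm => ?_
            rw [hxJ M m hm, hyJ M m hm]
            exact (ha m M hm).2.le
    · intro m hm
      rw [hx0 m hm, hy0 m hm, hW0]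
  obtain ⟨M, hM⟩ := hbounded
  -- from here on, `R` chains of `N` steps at almost all places of each scale beyond `M`
  have hgood : ∀ s, {m : ℕ | m.unpair.1 = M + 1 + s ∧ ∀ a < σ.N (ν (M + 1 + s)),
      W m a (a + 1) ≤ 2 ^ M * 2⁻¹ ^ σ.d (ν (M + 1 + s))}.Infinite := by
    intro s
    refine ((hcopies (M + 1 + s)).sdiff (hM (M + 1 + s) (by omega))).mono ?_
    rintro m ⟨hm, hm'⟩
    refine ⟨hm, fun a ha => ?_⟩
    by_contra hlt
    exact hm' ⟨hm, a, ha, not_le.1 hlt⟩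
  obtain ⟨J, hJS, hJc, hJd⟩ :=
    exists_pairwise_disjoint_finset_card hgood fun s => σ.R (ν (M + 1 + s))
  let y : ℕ → ℤ := fun m => if ∃ s, m ∈ J s then σ.N (ν m.unpair.1) else 0
  have hyJ : ∀ s, ∀ m ∈ J s, y m = σ.N (ν m.unpair.1) := fun s m hm => if_pos ⟨s, hm⟩
  have hy0 : ∀ m, (∀ s, m ∉ J s) → y m = 0 := fun m hm => if_neg (by push Not; exact hm)
  have hybd : ∀ m, 0 ≤ y m ∧ y m ≤ σ.N (ν m.unpair.1) := by
    intro m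
    by_cases hm : ∃ s, m ∈ J s
    · obtain ⟨s, hs⟩ := hm
      rw [hyJ s m hs]
      omega
    · push Not at hm
      rw [hy0 m hm]
      omega
  have hWfin : ∑' m, W m ((0 : ℕ → ℤ) m) (y m) ≠ ∞ := by
    rw [ENNReal.tsum_eq_tsum_sum_of_pairwise_disjoint hJd]
    · have : ∀ s, ∑ m ∈ J s, W m ((0 : ℕ → ℤ) m) (y m) ≤ 2 ^ M * (2 * 2⁻¹ ^ s) := by
        intro s
        set n := ν (M + 1 + s) with hn
        have hns : M + 1 + s ≤ n := hν.le_apply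
        calc ∑ m ∈ J s, W m ((0 : ℕ → ℤ) m) (y m)
            ≤ ∑ m ∈ J s, (σ.N n : ℝ≥0∞) ^ σ.t (n + 1) * (2 ^ M * 2⁻¹ ^ σ.d n) := by
              refine Finset.sum_le_sum fun m hm => ?_
              have h2 : m.unpair.1 = M + 1 + s := (hJS s hm).1
              have := hgrow m M (by rw [h2]; omega) (by rw [h2]; exact (hJS s hm).2)
              rw [hyJ s m hm]
              rwa [h2] at this ⊢
          _ = 2 ^ M * (σ.R n * (2⁻¹ ^ σ.d n * (σ.N n : ℝ≥0∞) ^ σ.t (n + 1))) := by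
              rw [Finset.sum_const, hJc, nsmul_eq_mul]
              ring
          _ ≤ 2 ^ M * (2 * 2⁻¹ ^ s) := by
              refine mul_le_mul' le_rfl ((σ.mul_le n).trans ?_)
              gcongr 2 * ?_
              exact pow_le_pow_right_of_le_one' (by simp) (by omega)
      refine ne_top_of_le_ne_top ?_ (ENNReal.tsum_le_tsum this)
      rw [ENNReal.tsum_mul_left, ENNReal.tsum_mul_left, ENNReal.tsum_geometric]
      simp [ENNReal.one_sub_inv_two, ENNReal.mul_eq_top]
    · intro m hm
      rw [hy0 m hm]
      exact hW0 m
  refine (hiff 0 y (fun m => by simp) hybd).2 hWfin ?_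
  rw [ENNReal.tsum_eq_tsum_sum_of_pairwise_disjoint hJd]
  · refine top_unique ?_
    rw [← ENNReal.tsum_const_eq_top_of_ne_zero (α := ℕ) (one_ne_zero (α := ℝ≥0∞))]
    refine ENNReal.tsum_le_tsum fun s => ?_
    refine (σ.one_le_mul (ν (M + 1 + s))).trans (le_of_eq ?_)
    rw [← hJc s, ← nsmul_eq_mul, ← Finset.sum_const]
    refine Finset.sum_congr rfl fun m hm => ?_
    have h2 : m.unpair.1 = M + 1 + s := (hJS s hm).1
    rw [hyJ s m hm, h2]
    simp [powTerm, Real.enorm_natCast]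
  · intro m hm
    rw [hy0 m hm]
    simpa using powTerm_self _ (ht1 _) 0

/-! ### Non-reducibility -/

/-- The point of `ℝ^ω × ℤ^(ω × ω)` with trivial real part and the given integers. -/
def ofIntSeq (x : ℕ → ℤ) : (ℕ → ℝ) × (ℕ × ℕ → ℤ) := (0, fun s => x (Nat.pair s.1 s.2))

theorem measurable_ofIntSeq : Measurable ofIntSeq :=
  measurable_const.prodMk (measurable_pi_lambda _ fun _ => measurable_pi_apply _)

namespace Scales

variable {p : ℝ} (σ : Scales p)

theorem powSum_ofIntSeq (a : ℕ → ℕ) (x y : ℕ → ℤ) :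
    σ.powSum a (ofIntSeq x) (ofIntSeq y) =
      ∑' j, powTerm (2⁻¹ ^ σ.d (a j.unpair.1)) (σ.t (a j.unpair.1)) (x j) (y j) := by
  have h1 : Function.support (fun i => powTerm (σ.weight a i) (σ.exponent a i)
      (mixedCoords (ofIntSeq x) i) (mixedCoords (ofIntSeq y) i)) ⊆ Set.range Sum.inr := by
    rintro (i | s) hi
    · refine absurd ?_ hi
      exact powTerm_self _ (σ.one_le_exponent a _) _
    · exact ⟨s, rfl⟩
  rw [powSum, ← Sum.inr_injective.tsum_eq h1, ← Nat.pairEquiv.tsum_eq]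
  refine tsum_congr fun s => ?_
  have hs : Nat.pairEquiv s = Nat.pair s.1 s.2 := rfl
  simp [weight, exponent, mixedCoords, ofIntSeq, hs]

theorem powSum_ofIntSeq_add_ne_top (a : ℕ → ℕ) (g g' : ℕ →₀ ℤ) (x : ℕ → ℤ) :
    σ.powSum a (ofIntSeq (⇑g + x)) (ofIntSeq (⇑g' + x)) ≠ ∞ := by
  classical
  have ht1 : ∀ n, 1 ≤ σ.t n := fun n => σ.one_le.trans (σ.le_t n)
  rw [powSum_ofIntSeq, tsum_eq_sum (s := g.support ∪ g'.support)]
  · refine ENNReal.sum_ne_top.2 fun j _ => ?_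
    exact ENNReal.mul_ne_top (by simp)
      (ENNReal.rpow_ne_top_of_nonneg (zero_le_one.trans (ht1 _)) enorm_ne_top)
  · intro j hj
    simp only [Finset.mem_union, Finsupp.mem_support_iff, not_or, not_not] at hj
    simp only [Pi.add_apply, hj.1, hj.2]
    exact powTerm_self _ (ht1 _) _

theorem powSum_ofIntSeq_spread (a : ℕ → ℕ) {k : ℕ → ℕ} (hk : StrictMono k) (z x y : ℕ → ℤ) :
    σ.powSum a (ofIntSeq (z + spread k x)) (ofIntSeq (z + spread k y)) =
      ∑' m, powTerm (2⁻¹ ^ σ.d (a (k m).unpair.1)) (σ.t (a (k m).unpair.1)) (x m) (y m) := by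
  rw [powSum_ofIntSeq, ← hk.injective.tsum_eq]
  · refine tsum_congr fun m => ?_
    simp [powTerm, spread_apply hk]
  · intro j hj
    by_contra hjk
    refine hj ?_
    have hjk' : ∀ m, k m ≠ j := fun m hm => hjk ⟨m, hm⟩
    simp only [Pi.add_apply, spread_apply_of_notMem _ hjk']
    exact powTerm_self _ (σ.one_le.trans (σ.le_t _)) _

/-- `σ.rel a` does not reduce to `σ.rel b` when infinitely many values of `a` are not values of
`b`. -/
theorem not_borelReducible {a b κ : ℕ → ℕ} (hκ : StrictMono fun r => a (κ r))
    (hb : ∀ r, a (κ r) ∉ Set.range b) :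
    ¬ BorelReducible (σ.rel a).rel (σ.rel b).rel := by
  rintro ⟨θ, hθ, hred⟩
  change (ℕ → ℝ) × (ℕ × ℕ → ℤ) → (ℕ → ℝ) × (ℕ × ℕ → ℤ) at θ
  have hred' : ∀ x y, σ.powSum a x y ≠ ∞ ↔ σ.powSum b (θ x) (θ y) ≠ ∞ := hred
  have hθ' : Measurable fun x => mixedCoords (θ (ofIntSeq x)) :=
    measurable_pi_lambda _ fun i =>
      (measurable_mixedCoords_apply i).comp ((hθ : Measurable θ).comp measurable_ofIntSeq)
  obtain ⟨C, hCδ, hCd, hCadd, hcont⟩ := hθ'.exists_isGδ_translationInvariant_continuousOn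
  obtain ⟨e⟩ : Nonempty (ℕ ≃ ℕ ⊕ ℕ × ℕ) := ⟨(Denumerable.eqv _).symm⟩
  set h : ℕ → (ℕ → ℤ) → (ℕ → ℤ) → ℝ≥0∞ := fun i x y =>
    powTerm (σ.weight b (e i)) (σ.exponent b (e i)) (mixedCoords (θ (ofIntSeq x)) (e i))
      (mixedCoords (θ (ofIntSeq y)) (e i)) with hh
  have hsum : ∀ x y, ∑' i, h i x y = σ.powSum b (θ (ofIntSeq x)) (θ (ofIntSeq y)) := fun x y =>
    e.tsum_eq fun i => powTerm (σ.weight b i) (σ.exponent b i) (mixedCoords (θ (ofIntSeq x)) i)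
      (mixedCoords (θ (ofIntSeq y)) i)
  have H : LocalizableFamily C (2 ^ σ.t 0) h :=
    { isGδ := hCδ
      dense := hCd
      add_mem := hCadd
      const_ne_top := by simp
      self := fun i x => powTerm_self _ (σ.one_le_exponent b _) _
      symm := fun i x y => powTerm_symm _ _ _ _
      triangle := fun i x y w =>
        powTerm_triangle _ (σ.one_le_exponent b _) (σ.exponent_le b _) _ _ _
      continuousOn := fun i => by
        have h1 : ContinuousOn (fun w => mixedCoords (θ (ofIntSeq w)) (e i)) C :=
          (continuous_apply (e i)).comp_continuousOn hcont
        have h2 : ContinuousOn (fun w : (ℕ → ℤ) × (ℕ → ℤ) =>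
            mixedCoords (θ (ofIntSeq w.1)) (e i) - mixedCoords (θ (ofIntSeq w.2)) (e i))
            (C ×ˢ C) :=
          (h1.comp continuous_fst.continuousOn fun w hw => hw.1).sub
            (h1.comp continuous_snd.continuousOn fun w hw => hw.2)
        have h3 : Continuous fun u : ℝ => σ.weight b (e i) * ‖u‖ₑ ^ σ.exponent b (e i) :=
          (ENNReal.continuous_const_mul (σ.weight_ne_top b _)).comp
            (ENNReal.continuous_rpow_const.comp continuous_enorm)
        exact h3.comp_continuousOn h2
      tsum_ne_top := fun g g' x => by
        rw [hsum, ← hred']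
        exact σ.powSum_ofIntSeq_add_ne_top a g g' x }
  obtain ⟨k, z, block, hk, hkS, hiff⟩ := H.exists_block_decomposition
    (S := fun m => {j | j.unpair.1 = κ m.unpair.1})
    (fun m => Set.infinite_of_injective_forall_mem (f := fun c => Nat.pair (κ m.unpair.1) c)
      (fun c c' h => (Nat.pair_eq_pair.1 h).2) (fun c => by simp))
    (fun j => σ.N (a j.unpair.1))
  have hkκ : ∀ m, (k m).unpair.1 = κ m.unpair.1 := hkS
  let pt : ℕ → ℤ → (ℕ → ℤ) := fun m u => z + spread k (Pi.single m u)
  refine σ.false_of_additive hκ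
    (W := fun m u v => ∑ i ∈ block m, h i (pt m u) (pt m v)) ?_ ?_ ?_
  · intro m
    exact Finset.sum_eq_zero fun i _ => H.self i _
  · intro m M hM hstep
    set n := a (κ m.unpair.1) with hn
    have hchain : ∀ i ∈ block m, h i (pt m 0) (pt m (σ.N n)) ≤
        (σ.N n : ℝ≥0∞) ^ (σ.t (n + 1) - 1) *
          ∑ u ∈ Finset.range (σ.N n), h i (pt m u) (pt m (u + 1)) := by
      intro i hi
      have := σ.powTerm_chain_le_of_notMem_range (hb m.unpair.1) hM (σ.N_pos n)
        (fun u : ℕ => θ (ofIntSeq (pt m u))) (e i) (fun u hu => ?_)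
      · simpa [hh] using this
      · refine le_trans ?_ (hstep u hu)
        have h1 := Finset.single_le_sum (f := fun i => h i (pt m u) (pt m (u + 1)))
          (fun i _ => zero_le) hi
        simpa [hh] using h1
    calc ∑ i ∈ block m, h i (pt m 0) (pt m (σ.N n))
        ≤ ∑ i ∈ block m, (σ.N n : ℝ≥0∞) ^ (σ.t (n + 1) - 1) *
          ∑ u ∈ Finset.range (σ.N n), h i (pt m u) (pt m (u + 1)) := Finset.sum_le_sum hchain
      _ = (σ.N n : ℝ≥0∞) ^ (σ.t (n + 1) - 1) *
          ∑ u ∈ Finset.range (σ.N n), ∑ i ∈ block m, h i (pt m u) (pt m (u + 1)) := by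
          rw [← Finset.mul_sum, Finset.sum_comm]
      _ ≤ (σ.N n : ℝ≥0∞) ^ (σ.t (n + 1) - 1) *
          ∑ u ∈ Finset.range (σ.N n), 2 ^ M * 2⁻¹ ^ σ.d n := by
          gcongr with u hu
          exact hstep u (Finset.mem_range.1 hu)
      _ = (σ.N n : ℝ≥0∞) ^ σ.t (n + 1) * (2 ^ M * 2⁻¹ ^ σ.d n) := by
          have hN0 : (σ.N n : ℝ≥0∞) ≠ 0 := by exact_mod_cast (σ.N_pos n).ne'
          have h1 : (σ.N n : ℝ≥0∞) ^ σ.t (n + 1) =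
              (σ.N n : ℝ≥0∞) ^ (σ.t (n + 1) - 1) * σ.N n := by
            conv_rhs => rw [← ENNReal.rpow_one (σ.N n : ℝ≥0∞), ← ENNReal.rpow_mul, one_mul,
              ← ENNReal.rpow_add _ _ hN0 (ENNReal.natCast_ne_top _), sub_add_cancel]
          rw [Finset.sum_const, Finset.card_range, nsmul_eq_mul, h1, mul_assoc]
  · intro x y hx hy
    have h1 := hiff x y (fun m => by rw [hkκ]; exact hx m) (fun m => by rw [hkκ]; exact hy m)
    rw [hsum, ← hred', powSum_ofIntSeq_spread _ _ hk] at h1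
    simpa only [hkκ] using h1

end Scales

/-! ### Hölder embeddings into `ℓ_q` -/

theorem memℓp_iff_tsum_enorm_ne_top {ι : Type*} {q : ℝ≥0∞} (hq : 0 < q.toReal) (f : ι → ℝ) :
    Memℓp f q ↔ ∑' i, ‖f i‖ₑ ^ q.toReal ≠ ∞ := by
  have h : ∀ i, ‖f i‖ₑ ^ q.toReal = ENNReal.ofReal (‖f i‖ ^ q.toReal) := fun i => by
    rw [← ofReal_norm, ENNReal.ofReal_rpow_of_nonneg (norm_nonneg _) hq.le]
  rw [memℓp_gen_iff hq]
  simp only [h]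
  refine ⟨fun hs => hs.tsum_ofReal_ne_top, fun hs => ?_⟩
  refine (ENNReal.summable_toReal hs).congr fun i => ?_
  exact ENNReal.toReal_ofReal (by positivity)

theorem realModEllp_iff {q : ℝ≥0∞} (hq : 0 < q.toReal) (x y : ℕ → ℝ) :
    realModEllp q x y ↔ ∑' i, ‖x i - y i‖ₑ ^ q.toReal ≠ ∞ :=
  memℓp_iff_tsum_enorm_ne_top hq (x - y)

/-- The two coordinates of the unit circle. -/
noncomputable def circleCoord (b : Bool) (u : ℝ) : ℝ := if b then Real.cos u else Real.sin u

theorem abs_circleCoord_sub_le_two (b : Bool) (u v : ℝ) :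
    |circleCoord b u - circleCoord b v| ≤ 2 := by
  rw [abs_le]
  cases b
  · simp only [circleCoord]
    constructor <;> norm_num <;>
      linarith [Real.neg_one_le_sin u, Real.sin_le_one u, Real.neg_one_le_sin v, Real.sin_le_one v]
  · simp only [circleCoord]
    constructor <;> norm_num <;>
      linarith [Real.neg_one_le_cos u, Real.cos_le_one u, Real.neg_one_le_cos v, Real.cos_le_one v]

theorem abs_circleCoord_sub_le (b : Bool) (u v : ℝ) :
    |circleCoord b u - circleCoord b v| ≤ |u - v| := by
  cases b
  · simpa [circleCoord] using Real.abs_sin_sub_sin_le u v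
  · simpa [circleCoord] using Real.abs_cos_sub_cos_le u v

theorem exists_half_le_abs_circleCoord_sub {u v : ℝ} (h1 : 1 ≤ |u - v|) (h2 : |u - v| ≤ 2) :
    ∃ b, 1 / 2 ≤ |circleCoord b u - circleCoord b v| := by
  have hcos : Real.cos (u - v) ≤ 5 / 9 := by
    rw [← Real.cos_abs]
    refine le_trans ?_ Real.cos_one_le
    exact Real.cos_le_cos_of_nonneg_of_le_pi zero_le_one (by linarith [Real.pi_gt_three]) h1
  rw [Real.cos_sub] at hcos
  by_contra! hcon
  have hc := hcon true
  have hs := hcon false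
  simp only [circleCoord, if_true, Bool.false_eq_true, if_false] at hc hs
  rw [abs_lt] at hc hs
  nlinarith [Real.sin_sq_add_cos_sq u, Real.sin_sq_add_cos_sq v]

/-- The `q`-th power of the `ℓ_q` distance between the images of `x` and `y` under the map which
winds the line around a circle of radius `2 ^ (-k * t / q)` at the speed `2 ^ k`, for all integers
`k`. -/
noncomputable def helixSum (q t x y : ℝ) : ℝ≥0∞ :=
  ∑' k : ℤ, ∑ b : Bool, ENNReal.ofReal ((2 : ℝ) ^ (-(k * t))) *
    ‖circleCoord b (2 ^ k * x) - circleCoord b (2 ^ k * y)‖ₑ ^ q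

theorem helixSum_self {q : ℝ} (hq : 0 < q) (t x : ℝ) : helixSum q t x x = 0 := by
  simp [helixSum, ENNReal.zero_rpow_of_pos hq]

theorem ofReal_mul_enorm_rpow {q : ℝ} (hq : 0 < q) {r : ℝ} (hr : 0 ≤ r) (a : ℝ) :
    ENNReal.ofReal r * ‖a‖ₑ ^ q = ENNReal.ofReal (r * |a| ^ q) := by
  rw [ENNReal.ofReal_mul hr, ← ENNReal.ofReal_rpow_of_nonneg (abs_nonneg a) hq.le,
    ← Real.norm_eq_abs, ofReal_norm]

theorem exists_zpow_mul_mem_Ico {d : ℝ} (hd : 0 < d) : ∃ k : ℤ, 1 ≤ 2 ^ k * d ∧ 2 ^ k * d < 2 := by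
  obtain ⟨n, hn1, hn2⟩ := exists_mem_Ioc_zpow (inv_pos.2 hd) (one_lt_two (α := ℝ))
  refine ⟨n + 1, ?_, ?_⟩
  · calc (1 : ℝ) = d⁻¹ * d := (inv_mul_cancel₀ hd.ne').symm
      _ ≤ 2 ^ (n + 1) * d := by gcongr
  · rw [zpow_add_one₀ two_ne_zero]
    have : (2 : ℝ) ^ n * d < 1 := by
      calc (2 : ℝ) ^ n * d < d⁻¹ * d := by gcongr
        _ = 1 := inv_mul_cancel₀ hd.ne'
    linarith

theorem two_rpow_le_rpow {k : ℤ} {d t : ℝ} (ht : 0 ≤ t) (hk : 1 ≤ 2 ^ k * d) :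
    (2 : ℝ) ^ (-(k * t)) ≤ d ^ t := by
  have h2 : (0 : ℝ) < 2 ^ k := by positivity
  have h1 : (2 : ℝ) ^ (-(k * t)) = ((2 ^ k)⁻¹ : ℝ) ^ t := by
    rw [← Real.rpow_intCast, ← Real.rpow_neg zero_le_two, ← Real.rpow_mul zero_le_two, neg_mul]
  rw [h1]
  refine Real.rpow_le_rpow (by positivity) ?_ ht
  rw [inv_le_iff_one_le_mul₀ h2]
  linarith

theorem rpow_le_mul_two_rpow {k : ℤ} {d t : ℝ} (hd : 0 ≤ d) (ht : 0 ≤ t) (hk : 2 ^ k * d ≤ 2) :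
    d ^ t ≤ 2 ^ t * (2 : ℝ) ^ (-(k * t)) := by
  have h2 : (0 : ℝ) < 2 ^ k := by positivity
  have h1 : (2 : ℝ) ^ (-(k * t)) = ((2 ^ k)⁻¹ : ℝ) ^ t := by
    rw [← Real.rpow_intCast, ← Real.rpow_neg zero_le_two, ← Real.rpow_mul zero_le_two, neg_mul]
  rw [h1, ← Real.mul_rpow zero_le_two (by positivity)]
  refine Real.rpow_le_rpow hd ?_ ht
  rw [← div_eq_mul_inv, le_div_iff₀ h2]
  linarith

/-- The upper bound for a single term of `helixSum`, with exponentially small factors away from the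
scale `2 ^ (-k)` of the distance `|x - y|`. -/
theorem helix_term_le {q T t : ℝ} (ht : 1 ≤ t) (hT : t ≤ T) (hq : T < q) {x y : ℝ} {k : ℤ}
    (hk1 : 1 ≤ 2 ^ k * |x - y|) (hk2 : 2 ^ k * |x - y| < 2) (j : ℤ) (b : Bool) :
    (2 : ℝ) ^ (-(((j + k : ℤ) : ℝ) * t)) *
        |circleCoord b (2 ^ (j + k) * x) - circleCoord b (2 ^ (j + k) * y)| ^ q ≤
      |x - y| ^ t * (2 ^ q * 2 ^ (-(min 1 (q - T) * |(j : ℝ)|))) := by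
  have hq0 : 0 < q := by linarith
  have hs : min 1 (q - T) ≤ 1 := min_le_left _ _
  have hs' : min 1 (q - T) ≤ q - T := min_le_right _ _
  have hΔ : |circleCoord b (2 ^ (j + k) * x) - circleCoord b (2 ^ (j + k) * y)| ^ q *
      2 ^ (-((j : ℝ) * t)) ≤ 2 ^ q * 2 ^ (-(min 1 (q - T) * |(j : ℝ)|)) := by
    rcases le_total 0 j with hj | hj
    · have hj' : (0 : ℝ) ≤ j := by exact_mod_cast hj
      rw [abs_of_nonneg hj']
      refine mul_le_mul ?_ ?_ (by positivity) (by positivity)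
      · exact Real.rpow_le_rpow (abs_nonneg _) (abs_circleCoord_sub_le_two _ _ _) hq0.le
      · refine Real.rpow_le_rpow_of_exponent_le one_le_two ?_
        nlinarith
    · have hj' : (j : ℝ) ≤ 0 := by exact_mod_cast hj
      rw [abs_of_nonpos hj']
      have h1 : |circleCoord b (2 ^ (j + k) * x) - circleCoord b (2 ^ (j + k) * y)| ≤
          2 * (2 : ℝ) ^ (j : ℝ) := by
        refine (abs_circleCoord_sub_le _ _ _).trans ?_
        rw [← mul_sub, abs_mul, abs_of_pos (by positivity : (0 : ℝ) < 2 ^ (j + k)),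
          zpow_add₀ two_ne_zero, Real.rpow_intCast]
        have : (0 : ℝ) < 2 ^ j := by positivity
        nlinarith
      calc _ ≤ (2 * (2 : ℝ) ^ (j : ℝ)) ^ q * 2 ^ (-((j : ℝ) * t)) := by
            gcongr
        _ = 2 ^ q * 2 ^ ((j : ℝ) * (q - t)) := by
            rw [Real.mul_rpow zero_le_two (by positivity), ← Real.rpow_mul zero_le_two, mul_assoc,
              ← Real.rpow_add zero_lt_two]
            ring_nf
        _ ≤ _ := by
            refine mul_le_mul_of_nonneg_left ?_ (by positivity)
            refine Real.rpow_le_rpow_of_exponent_le one_le_two ?_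
            nlinarith
  calc _ = 2 ^ (-((k : ℝ) * t)) *
        (|circleCoord b (2 ^ (j + k) * x) - circleCoord b (2 ^ (j + k) * y)| ^ q *
          2 ^ (-((j : ℝ) * t))) := by
        rw [Int.cast_add, add_mul, neg_add, Real.rpow_add zero_lt_two]
        ring
    _ ≤ _ := by
        gcongr
        exact two_rpow_le_rpow (zero_le_one.trans ht) hk1

theorem summable_two_rpow_neg_mul_abs {s : ℝ} (hs : 0 < s) :
    Summable fun j : ℤ => (2 : ℝ) ^ (-(s * |(j : ℝ)|)) := by
  have h : Summable fun n : ℕ => ((2 : ℝ) ^ (-s)) ^ n := by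
    refine summable_geometric_of_lt_one (by positivity) ?_
    exact Real.rpow_lt_one_of_one_lt_of_neg one_lt_two (by linarith)
  have h' : Summable fun n : ℕ => (2 : ℝ) ^ (-(s * (n : ℝ))) := by
    refine h.congr fun n => ?_
    rw [← Real.rpow_natCast, ← Real.rpow_mul zero_le_two, neg_mul]
  refine Summable.of_nat_of_neg ?_ ?_
  · simpa using h'
  · simpa using h'

theorem exists_helixSum_le {q T : ℝ} (hq : T < q) : ∃ A : ℝ≥0∞, A ≠ ∞ ∧
    ∀ t, 1 ≤ t → t ≤ T → ∀ x y, helixSum q t x y ≤ A * ‖x - y‖ₑ ^ t := by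
  set g : ℤ → ℝ := fun j => 2 ^ q * 2 ^ (-(min 1 (q - T) * |(j : ℝ)|)) with hg
  have hs : 0 < min 1 (q - T) := lt_min one_pos (by linarith)
  have hgs : Summable g := (summable_two_rpow_neg_mul_abs hs).mul_left _
  refine ⟨∑' j, 2 * ENNReal.ofReal (g j), ?_, fun t ht hT x y => ?_⟩
  · rw [ENNReal.tsum_mul_left]
    exact ENNReal.mul_ne_top (by simp) hgs.tsum_ofReal_ne_top
  have hq0 : 0 < q := by linarith
  rcases eq_or_ne x y with rfl | hxy
  · rw [helixSum_self hq0]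
    exact zero_le
  obtain ⟨k, hk1, hk2⟩ := exists_zpow_mul_mem_Ico (abs_pos.2 (sub_ne_zero.2 hxy))
  rw [helixSum, ← (Equiv.addRight k).tsum_eq, ← ENNReal.tsum_mul_right]
  refine ENNReal.tsum_le_tsum fun j => ?_
  have hterm : ∀ b, ENNReal.ofReal ((2 : ℝ) ^ (-(((j + k : ℤ) : ℝ) * t))) *
      ‖circleCoord b (2 ^ (j + k) * x) - circleCoord b (2 ^ (j + k) * y)‖ₑ ^ q ≤
      ENNReal.ofReal (g j) * ‖x - y‖ₑ ^ t := by
    intro b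
    rw [ofReal_mul_enorm_rpow hq0 (by positivity),
      ofReal_mul_enorm_rpow (by linarith) (by positivity)]
    refine ENNReal.ofReal_le_ofReal ?_
    rw [mul_comm (g j)]
    exact helix_term_le ht hT hq hk1 hk2 j b
  rw [Fintype.sum_bool, Equiv.coe_addRight]
  calc _ ≤ ENNReal.ofReal (g j) * ‖x - y‖ₑ ^ t + ENNReal.ofReal (g j) * ‖x - y‖ₑ ^ t :=
        add_le_add (hterm true) (hterm false)
    _ = _ := by ring

theorem le_mul_helixSum {q T t : ℝ} (ht : 1 ≤ t) (hT : t ≤ T) (hq : T < q) (x y : ℝ) :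
    ‖x - y‖ₑ ^ t ≤ ENNReal.ofReal (2 ^ T * 2 ^ q) * helixSum q t x y := by
  have hq0 : 0 < q := by linarith
  rcases eq_or_ne x y with rfl | hxy
  · simp [ENNReal.zero_rpow_of_pos (zero_lt_one.trans_le ht)]
  obtain ⟨k, hk1, hk2⟩ := exists_zpow_mul_mem_Ico (abs_pos.2 (sub_ne_zero.2 hxy))
  have hpos : (0 : ℝ) < 2 ^ k := by positivity
  have habs : |2 ^ k * x - 2 ^ k * y| = 2 ^ k * |x - y| := by
    rw [← mul_sub, abs_mul, abs_of_pos hpos]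
  obtain ⟨b, hb⟩ := exists_half_le_abs_circleCoord_sub (u := 2 ^ k * x) (v := 2 ^ k * y)
    (by rw [habs]; exact hk1) (by rw [habs]; exact hk2.le)
  have h1 : ENNReal.ofReal ((2 : ℝ) ^ (-(k * t))) *
      ‖circleCoord b (2 ^ k * x) - circleCoord b (2 ^ k * y)‖ₑ ^ q ≤ helixSum q t x y :=
    (Finset.single_le_sum (f := fun b => ENNReal.ofReal ((2 : ℝ) ^ (-(k * t))) *
      ‖circleCoord b (2 ^ k * x) - circleCoord b (2 ^ k * y)‖ₑ ^ q)
      (fun _ _ => zero_le) (Finset.mem_univ b)).trans (ENNReal.le_tsum k)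
  refine le_trans ?_ (mul_le_mul' le_rfl h1)
  have h2 : ‖x - y‖ₑ ^ t = ENNReal.ofReal (|x - y| ^ t) := by
    simpa using ofReal_mul_enorm_rpow (zero_lt_one.trans_le ht) zero_le_one (x - y)
  rw [h2, ofReal_mul_enorm_rpow hq0 (by positivity), ← ENNReal.ofReal_mul (by positivity)]
  refine ENNReal.ofReal_le_ofReal ?_
  have h3 : (1 / 2 : ℝ) ^ q ≤ |circleCoord b (2 ^ k * x) - circleCoord b (2 ^ k * y)| ^ q :=
    Real.rpow_le_rpow (by norm_num) hb hq0.le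
  have h4 : (2 : ℝ) ^ q * (1 / 2) ^ q = 1 := by
    rw [← Real.mul_rpow (by norm_num) (by norm_num)]
    norm_num
  calc |x - y| ^ t ≤ 2 ^ t * (2 : ℝ) ^ (-(k * t)) :=
        rpow_le_mul_two_rpow (abs_nonneg _) (zero_le_one.trans ht) hk2.le
    _ ≤ 2 ^ T * (2 : ℝ) ^ (-(k * t)) := by
        gcongr
        norm_num
    _ = 2 ^ T * 2 ^ q * (2 ^ (-(k * t)) * (1 / 2) ^ q) := by
        linear_combination -(2 ^ T * (2 : ℝ) ^ (-(k * t))) * h4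
    _ ≤ _ := by gcongr

/-- The image of a real family under the helix maps, with the given weights and exponents. -/
noncomputable def helixMap {ι : Type*} (q : ℝ) (c : ι → ℝ≥0∞) (t : ι → ℝ) (x : ι → ℝ) :
    ι × ℤ × Bool → ℝ := fun s =>
  ((c s.1).toReal * (2 : ℝ) ^ (-(s.2.1 * t s.1))) ^ q⁻¹ * circleCoord s.2.2 (2 ^ s.2.1 * x s.1)

theorem measurable_helixMap {ι : Type*} (q : ℝ) (c : ι → ℝ≥0∞) (t : ι → ℝ) :
    Measurable (helixMap q c t) := by
  refine measurable_pi_lambda _ fun s => ?_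
  have h : Measurable (circleCoord s.2.2) := by
    cases s.2.2
    · exact Real.measurable_sin
    · exact Real.measurable_cos
  exact (h.comp ((measurable_pi_apply s.1).const_mul _)).const_mul _

theorem tsum_helixMap_sub {ι : Type*} {q : ℝ} (hq : 0 < q) {c : ι → ℝ≥0∞} (hc : ∀ i, c i ≠ ∞)
    (t : ι → ℝ) (x y : ι → ℝ) :
    ∑' s, ‖helixMap q c t x s - helixMap q c t y s‖ₑ ^ q =
      ∑' i, c i * helixSum q (t i) (x i) (y i) := by
  rw [ENNReal.tsum_prod']
  refine tsum_congr fun i => ?_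
  rw [ENNReal.tsum_prod', helixSum, ← ENNReal.tsum_mul_left]
  refine tsum_congr fun k => ?_
  rw [tsum_fintype, Finset.mul_sum]
  refine Finset.sum_congr rfl fun b _ => ?_
  have hr : 0 ≤ (c i).toReal * (2 : ℝ) ^ (-(k * t i)) := by positivity
  rw [helixMap, helixMap, ← mul_sub, enorm_mul, ENNReal.mul_rpow_of_nonneg _ _ hq.le, ← mul_assoc]
  congr 1
  rw [Real.enorm_of_nonneg (by positivity), ENNReal.ofReal_rpow_of_nonneg (by positivity) hq.le,
    ← Real.rpow_mul hr, inv_mul_cancel₀ hq.ne', Real.rpow_one,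
    ENNReal.ofReal_mul ENNReal.toReal_nonneg, ENNReal.ofReal_toReal (hc i)]

theorem tsum_helixMap_sub_ne_top_iff {ι : Type*} {q T : ℝ} (hq : T < q) {c : ι → ℝ≥0∞}
    (hc : ∀ i, c i ≠ ∞) {t : ι → ℝ} (ht : ∀ i, 1 ≤ t i) (hT : ∀ i, t i ≤ T) (hT1 : 1 ≤ T)
    (x y : ι → ℝ) :
    ∑' s, ‖helixMap q c t x s - helixMap q c t y s‖ₑ ^ q ≠ ∞ ↔
      ∑' i, powTerm (c i) (t i) (x i) (y i) ≠ ∞ := by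
  obtain ⟨A, hA, hAle⟩ := exists_helixSum_le hq
  rw [tsum_helixMap_sub (by linarith) hc]
  constructor
  · intro h
    refine ne_top_of_le_ne_top (b := ENNReal.ofReal (2 ^ T * 2 ^ q) *
      ∑' i, c i * helixSum q (t i) (x i) (y i)) (ENNReal.mul_ne_top ENNReal.ofReal_ne_top h) ?_
    rw [← ENNReal.tsum_mul_left]
    refine ENNReal.tsum_le_tsum fun i => ?_
    rw [powTerm, mul_left_comm]
    exact mul_le_mul' le_rfl (le_mul_helixSum (ht i) (hT i) hq _ _)
  · intro h
    refine ne_top_of_le_ne_top (b := A * ∑' i, powTerm (c i) (t i) (x i) (y i))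
      (ENNReal.mul_ne_top hA h) ?_
    rw [← ENNReal.tsum_mul_left]
    refine ENNReal.tsum_le_tsum fun i => ?_
    rw [powTerm, mul_left_comm]
    exact mul_le_mul' le_rfl (hAle _ (ht i) (hT i) _ _)

namespace Scales

theorem rel_borelReducible_realModEllp {p : ℝ} (σ : Scales p) (a : ℕ → ℕ) {q : ℝ≥0∞}
    (hq : σ.t 0 < q.toReal) : BorelReducible (σ.rel a).rel (realModEllp q) := by
  have h1 : 1 ≤ σ.t 0 := σ.one_le.trans σ.p_le_t_zero
  obtain ⟨e⟩ : Nonempty (ℕ ≃ (ℕ ⊕ ℕ × ℕ) × ℤ × Bool) := nonempty_equiv_of_countable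
  have hm : Measurable fun x : (ℕ → ℝ) × (ℕ × ℕ → ℤ) => mixedCoords x :=
    measurable_pi_lambda _ measurable_mixedCoords_apply
  let f : (ℕ → ℝ) × (ℕ × ℕ → ℤ) → ℕ → ℝ := fun x i =>
    helixMap q.toReal (σ.weight a) (σ.exponent a) (mixedCoords x) (e i)
  have hf : Measurable f := measurable_pi_lambda _ fun i =>
    (measurable_pi_apply (e i)).comp ((measurable_helixMap _ _ _).comp hm)
  have hred : ∀ x y, σ.powSum a x y ≠ ∞ ↔ realModEllp q (f x) (f y) := by
    intro x y
    rw [realModEllp_iff (by linarith), powSum, ← tsum_helixMap_sub_ne_top_iff hq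
      (σ.weight_ne_top a) (σ.one_le_exponent a) (σ.exponent_le a) h1, ← e.tsum_eq]
  exact ⟨f, hf, hred⟩

theorem realModEllp_borelReducible_rel {p : ℝ≥0∞} (σ : Scales p.toReal) (a : ℕ → ℕ) :
    BorelReducible (realModEllp p) (σ.rel a).rel := by
  refine ⟨fun x => ((x, 0) : (ℕ → ℝ) × (ℕ × ℕ → ℤ)), measurable_id.prodMk measurable_const, ?_⟩
  intro x y
  rw [realModEllp_iff (zero_lt_one.trans_le σ.one_le), rel_iff, powSum,
    ← Sum.inl_injective.tsum_eq]
  · simp [powTerm, weight, exponent, mixedCoords]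
  · rintro (i | s) hi
    · exact ⟨i, rfl⟩
    · refine absurd ?_ hi
      exact powTerm_self _ (σ.one_le_exponent a _) _

end Scales

/-! ### Choice of the parameters -/

theorem exists_scales {p q : ℝ} (hp : 1 ≤ p) (hpq : p < q) : ∃ σ : Scales p, σ.t 0 < q := by
  -- `N n = 2 ^ s n`, with `s n` so large that `N n ^ (t n - t (n + 1)) ≥ 2 ^ n`, and `d n` so large
  -- that the weighted `t n`-th power of `N n` is at most `1`
  set t : ℕ → ℝ := fun n => p + (q - p) / (n + 2) with ht
  have hqp : 0 < q - p := by linarith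
  have hanti : StrictAnti t := strictAnti_nat_of_succ_lt fun n => by
    simp only [ht]
    gcongr
    simp
  have hle : ∀ n, p ≤ t n := fun n => by
    have : 0 ≤ (q - p) / ((n : ℝ) + 2) := by positivity
    simp only [ht]
    linarith
  have hs : ∀ n : ℕ, ∃ s : ℕ, (n : ℝ) ≤ s * (t n - t (n + 1)) := fun n => by
    obtain ⟨s, hs⟩ := Archimedean.arch (n : ℝ) (sub_pos.2 (hanti n.lt_succ_self))
    exact ⟨s, by simpa using hs⟩
  choose s hs using hs
  have he : ∀ n, ∃ e : ℕ, s n * t n ≤ e := fun n => exists_nat_ge _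
  choose e he using he
  set d : ℕ → ℕ := fun n => ∑ i ∈ Finset.range (n + 1), (i + e i) with hd
  have hed : ∀ n, (s n : ℝ) * t n ≤ d n := fun n => by
    refine (he n).trans ?_
    have : e n ≤ d n := by
      simp only [hd, Finset.sum_range_succ]
      omega
    exact_mod_cast this
  have hN : ∀ (n : ℕ) (u : ℝ), 0 ≤ u →
      (((2 ^ s n : ℕ) : ℝ≥0∞)) ^ u = ENNReal.ofReal ((2 : ℝ) ^ (s n * u)) := by
    intro n u hu
    rw [Real.rpow_mul zero_le_two, ← ENNReal.ofReal_rpow_of_nonneg (by positivity) hu,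
      Real.rpow_natCast, ENNReal.ofReal_pow zero_le_two]
    simp
  have h2 : ∀ n : ℕ, (2⁻¹ : ℝ≥0∞) ^ n = ENNReal.ofReal ((2 : ℝ) ^ (-(n : ℝ))) := by
    intro n
    rw [Real.rpow_neg zero_le_two, Real.rpow_natCast, ENNReal.ofReal_inv_of_pos (by positivity),
      ENNReal.ofReal_pow zero_le_two, ENNReal.inv_pow]
    simp
  have ht0 : ∀ n, 0 ≤ t n := fun n => by linarith [hle n]
  -- the least number of copies for which the `t n`-th powers add up to at least `1`
  set R : ℕ → ℕ := fun n => ⌈(2 : ℝ) ^ ((d n : ℝ) - s n * t n)⌉₊ with hR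
  have hR1 : ∀ n, (2 : ℝ) ^ ((d n : ℝ) - s n * t n) ≤ R n := fun n => Nat.le_ceil _
  have hR2 : ∀ n, (R n : ℝ) ≤ 2 * (2 : ℝ) ^ ((d n : ℝ) - s n * t n) := fun n => by
    have h1 : (1 : ℝ) ≤ (2 : ℝ) ^ ((d n : ℝ) - s n * t n) :=
      Real.one_le_rpow one_le_two (by linarith [hed n])
    have := Nat.ceil_lt_add_one (zero_le_one.trans h1)
    simp only [hR]
    linarith
  have hmul : ∀ (n : ℕ) (u : ℝ), 0 ≤ u →
      (R n : ℝ≥0∞) * (2⁻¹ ^ d n * ((2 ^ s n : ℕ) : ℝ≥0∞) ^ u) =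
        ENNReal.ofReal (R n * (2 : ℝ) ^ (s n * u - d n)) := by
    intro n u hu
    rw [h2, hN n u hu, ← ENNReal.ofReal_mul (by positivity), ← Real.rpow_add zero_lt_two,
      ENNReal.ofReal_mul (by positivity), ENNReal.ofReal_natCast]
    ring_nf
  refine ⟨⟨t, d, fun n => 2 ^ s n, R, hp, hanti, hle, ?_, ?_, ?_, ?_⟩, ?_⟩
  · intro m n hmn
    have h1 : d m ≤ ∑ i ∈ Finset.range n, (i + e i) :=
      Finset.sum_le_sum_of_subset (Finset.range_subset_range.2 hmn)
    have h3 : d n = ∑ i ∈ Finset.range n, (i + e i) + (n + e n) := Finset.sum_range_succ _ _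
    omega
  · intro n
    positivity
  · intro n
    rw [hmul n _ (ht0 n), ENNReal.one_le_ofReal]
    calc (1 : ℝ) = 2 ^ ((d n : ℝ) - s n * t n) * 2 ^ (s n * t n - d n) := by
          rw [← Real.rpow_add zero_lt_two]
          simp
      _ ≤ _ := by
          gcongr
          exact hR1 n
  · intro n
    rw [hmul n _ (ht0 _), h2]
    have : (2 : ℝ≥0∞) = ENNReal.ofReal 2 := by simp
    rw [this, ← ENNReal.ofReal_mul zero_le_two]
    refine ENNReal.ofReal_le_ofReal ?_
    calc (R n : ℝ) * 2 ^ (s n * t (n + 1) - d n)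
        ≤ 2 * 2 ^ ((d n : ℝ) - s n * t n) * 2 ^ (s n * t (n + 1) - d n) := by
          gcongr
          exact hR2 n
      _ = 2 * 2 ^ (-(s n * (t n - t (n + 1)))) := by
          rw [mul_assoc, ← Real.rpow_add zero_lt_two]
          ring_nf
      _ ≤ 2 * 2 ^ (-(n : ℝ)) := by
          gcongr
          · norm_num
          · exact hs n
  · simp only [ht, Nat.cast_zero, zero_add]
    linarith

/-- The number whose binary digits are `1, ξ 0, …, ξ (k - 1)`: a code for the restriction of `ξ` to
`k`. -/
def branchCode (ξ : ℕ → Bool) : ℕ → ℕ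
  | 0 => 1
  | k + 1 => 2 * branchCode ξ k + (ξ k).toNat

theorem two_pow_le_branchCode (ξ : ℕ → Bool) (k : ℕ) : 2 ^ k ≤ branchCode ξ k := by
  induction k with
  | zero => simp [branchCode]
  | succ k ih => simp only [branchCode, pow_succ]; omega

theorem branchCode_lt_two_pow (ξ : ℕ → Bool) (k : ℕ) : branchCode ξ k < 2 ^ (k + 1) := by
  induction k with
  | zero => simp [branchCode]
  | succ k ih =>
    have := Bool.toNat_le (ξ k)
    simp only [branchCode, pow_succ] at ih ⊢
    omega

theorem strictMono_branchCode (ξ : ℕ → Bool) : StrictMono (branchCode ξ) :=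
  strictMono_nat_of_lt_succ fun k =>
    (branchCode_lt_two_pow ξ k).trans_le (two_pow_le_branchCode ξ (k + 1))

theorem eq_of_branchCode_eq {ξ ζ : ℕ → Bool} {k l : ℕ} (h : branchCode ξ k = branchCode ζ l) :
    k = l := by
  have h1 : 2 ^ k < 2 ^ (l + 1) :=
    (two_pow_le_branchCode ξ k).trans_lt (h ▸ branchCode_lt_two_pow ζ l)
  have h2 : 2 ^ l < 2 ^ (k + 1) :=
    (two_pow_le_branchCode ζ l).trans_lt (h ▸ branchCode_lt_two_pow ξ k)
  rw [Nat.pow_lt_pow_iff_right one_lt_two] at h1 h2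
  omega

theorem apply_eq_of_branchCode_eq {ξ ζ : ℕ → Bool} {k : ℕ} (h : branchCode ξ k = branchCode ζ k) :
    ∀ i < k, ξ i = ζ i := by
  induction k with
  | zero => simp
  | succ k ih =>
    have h1 := Bool.toNat_le (ξ k)
    have h2 := Bool.toNat_le (ζ k)
    simp only [branchCode] at h
    intro i hi
    rcases Nat.lt_succ_iff_lt_or_eq.1 hi with hi | rfl
    · exact ih (by omega) i hi
    · have h3 : (ξ i).toNat = (ζ i).toNat := by omega
      cases hξ : ξ i <;> cases hζ : ζ i <;> simp [hξ, hζ] at h3 ⊢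

/-! ### The family between `ℓ_p` and `ℓ_q` -/

theorem Scales.not_borelReducible_branchCode {p : ℝ} (σ : Scales p) {ξ ζ : ℕ → Bool}
    (h : ξ ≠ ζ) :
    ¬ BorelReducible (σ.rel (branchCode ξ)).rel (σ.rel (branchCode ζ)).rel := by
  obtain ⟨m, hm⟩ := Function.ne_iff.1 h
  refine σ.not_borelReducible (κ := fun r => m + 1 + r)
    ((strictMono_branchCode ξ).comp fun r s hrs => by simpa using hrs) ?_
  rintro r ⟨l, hl⟩
  obtain rfl := eq_of_branchCode_eq hl
  exact hm (apply_eq_of_branchCode_eq hl m (by omega)).symm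

theorem mainTheorem2 (p q : ℝ≥0∞) (hp : 1 ≤ p) (hpq : p < q) (hq : q < ∞) :
    ∃ E : (ℕ → Bool) → BorelEquivRel,
      (∀ ξ : ℕ → Bool,
        BorelReducible (realModEllp p) (E ξ).rel ∧ BorelReducible (E ξ).rel (realModEllp q)) ∧
      ∀ ξ ζ : ℕ → Bool, ξ ≠ ζ → BorelIncomparable (E ξ).rel (E ζ).rel := by
  have hp' : 1 ≤ p.toReal := by
    simpa using ENNReal.toReal_mono (hpq.trans hq).ne hp
  have hpq' : p.toReal < q.toReal := (ENNReal.toReal_lt_toReal (hpq.trans hq).ne hq.ne).2 hpq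
  obtain ⟨σ, hσ⟩ := exists_scales hp' hpq'
  exact ⟨fun ξ => σ.rel (branchCode ξ),
    fun ξ => ⟨σ.realModEllp_borelReducible_rel _, σ.rel_borelReducible_realModEllp _ hσ⟩,
    fun ξ ζ h => ⟨σ.not_borelReducible_branchCode h, σ.not_borelReducible_branchCode h.symm⟩⟩
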